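/- Let $\mathbb O=\mathbb H\oplus \ell\,\mathbb H$ be the octonions, with multiplication $(a+\ell b)(c+\ell d)=(ac-\bar d b)+\ell(b\bar c+da)$, let $\mathcal Y\cong\mathbb R^7$ be the space of imaginary octonions with its Euclidean scalar product $\langle\cdot,\cdot\rangle$ and cross product $A\times B=\tfrac12(AB-BA)$, and let $G_2$ be the group of linear automorphisms of $(\mathcal Y,\times)$, with Lie algebra $\mathfrak g_2$ (the derivations of $\times$). Let $S^6\subset\mathcal Y$ be the unit sphere with the round metric $g$, outward unit normal $N$ (so $N_x=x$), and almost complex structure $JX=N\times X$. The formula $JW=N\times W$ is also used for vectors $W\in\mathcal Y$ at a point of $S^6$ that are not tangent to $S^6$. Fix $o\in S^6$, let $H\subset G_2$ be its isotropy group and $\mathfrak h=\{D\in\mathfrak g_2: D(o)=0\}$ its Lie algebra. A reductive complement is an $\mathrm{Ad}(H)$-invariant subspace $\mathfrak m$ with $\mathfrak g_2=\mathfrak h\oplus\mathfrak m$; it is identified with $T_oS^6$ by $X\mapsto X(o)$ and carries the corresponding scalar product $\langle X,Y\rangle=\langle X(o),Y(o)\rangle$. It makes $S^6$ naturally reductive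 if $\langle[X,Y]_{\mathfrak m},Z\rangle=-\langle[X,Z]_{\mathfrak m},Y\rangle$ for all $X,Y,Z\in\mathfrak m$. In that case the canonical connection is the metric connection whose torsion, as a $(0,3)$-tensor, is the $G_2$-invariant tensor on $S^6$ that equals $T(X,Y,Z)=-\langle[X,Y]_{\mathfrak m},Z\rangle$ on $\mathfrak m\cong T_oS^6$. The characteristic connection of $(S^6,g,J)$ is the metric connection $\nabla$ with $\nabla J=0$ and totally skew symmetric torsion. The torsion is $T(X,Y,Z)=g(\nabla_XY-\nabla_YX-[X,Y],Z)$. **Proposition.** For every $o\in S^6$ the following hold. 1. $G_2$ acts by isometries, and $S^6=G_2/\mathrm{SU}(3)$: the orbit map $G_2\to S^6$, $a\mapsto a(o)$, has surjective differential $\mathfrak g_2\to T_oS^6$ and induces a homeomorphism $G_2/H\cong S^6$, and $H\cong\mathrm{SU}(3)$ as topological groups. 2. This homogeneous space is naturally reductive: there is a reductive complement $\mathfrak m$ with $\langle[X,Y]_{\mathfrak m},Z\rangle=-\langle[X,Z]_{\mathfrak m},Y\rangle$ for all $X,Y,Z\in\mathfrak m$. 3. The characteristic connection exists, is smooth, and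 is unique. For every $\mathfrak m$ as in 2, the canonical connection coincides with the characteristic connection. 4. The torsion of this connection is $$T^c(X,Y,Z)=-\langle J(X\times Y),Z\rangle=-\langle N,(X\times Y)\times Z\rangle$$ for all tangent vectors $X,Y,Z$ at a point of $S^6$. -/

import Mathlib

open scoped Quaternion Manifold ContDiff InnerProductSpace

attribute [local instance] LieRing.ofAssociativeRing

noncomputable section

/-! ### Octonions and the Cayley space -/

/-- Octonions. The pair `(a, b)` stands for `a + ℓ b`, where `ℓ` is the additional imaginary unit
of the Cayley-Dickson construction; the norm is the Euclidean norm of `ℝ⁸`. -/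
abbrev Octonion : Type := WithLp 2 (ℍ[ℝ] × ℍ[ℝ])

namespace Octonion

/-- Octonion multiplication `(a + ℓ b)(c + ℓ d) = (a c - d̄ b) + ℓ (b c̄ + d a)`. -/
def mul (z w : Octonion) : Octonion :=
  WithLp.toLp 2 (z.fst * w.fst - star w.snd * z.snd, z.snd * star w.fst + w.snd * z.fst)

/-- The norm is multiplicative, so this is the normed division algebra of octonions. -/
theorem norm_mul (z w : Octonion) : ‖mul z w‖ = ‖z‖ * ‖w‖ := by
  have key : ‖mul z w‖ ^ 2 = (‖z‖ * ‖w‖) ^ 2 := by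
    rw [mul_pow, WithLp.prod_norm_sq_eq_of_L2, WithLp.prod_norm_sq_eq_of_L2,
      WithLp.prod_norm_sq_eq_of_L2]
    simp only [mul, sq, ← Quaternion.normSq_eq_norm_mul_self, Quaternion.normSq_def']
    simp
    ring
  exact (sq_eq_sq₀ (norm_nonneg _) (by positivity)).1 key

theorem add_mul' (z z' w : Octonion) : mul (z + z') w = mul z w + mul z' w := by
  apply WithLp.ofLp_injective 2
  apply Prod.ext <;> simp [mul, add_mul, mul_add] <;> abel

theorem mul_add' (z w w' : Octonion) : mul z (w + w') = mul z w + mul z w' := by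
  apply WithLp.ofLp_injective 2
  apply Prod.ext <;> simp [mul, add_mul, mul_add] <;> abel

theorem smul_mul' (r : ℝ) (z w : Octonion) : mul (r • z) w = r • mul z w := by
  apply WithLp.ofLp_injective 2
  apply Prod.ext <;> simp [mul, smul_sub]

theorem mul_smul' (r : ℝ) (z w : Octonion) : mul z (r • w) = r • mul z w := by
  apply WithLp.ofLp_injective 2
  apply Prod.ext <;> simp [mul, smul_sub]

/-- The real part of an octonion. -/
def reL : Octonion →ₗ[ℝ] ℝ where
  toFun z := z.fst.re
  map_add' _ _ := by simp
  map_smul' _ _ := by simp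

theorem reL_apply (z : Octonion) : reL z = z.fst.re := rfl

end Octonion

/-- The space `𝒴` of imaginary octonions, with the scalar product induced from `ℝ⁸`. -/
abbrev Cayley : Type := LinearMap.ker Octonion.reL

instance : NormedAddCommGroup Cayley := inferInstance
instance : InnerProductSpace ℝ Cayley := inferInstance
instance : FiniteDimensional ℝ Cayley := inferInstance
instance : CompleteSpace Cayley := FiniteDimensional.complete ℝ Cayley
instance : NormedRing (Cayley →L[ℝ] Cayley) := inferInstance
instance : NormedAlgebra ℝ (Cayley →L[ℝ] Cayley) := inferInstance
instance : IsTopologicalRing (Cayley →L[ℝ] Cayley) := inferInstance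

instance : Fact (Module.finrank ℝ Cayley = 6 + 1) := ⟨by
  have h := LinearMap.finrank_range_add_finrank_ker Octonion.reL
  have h1 : Module.finrank ℝ Octonion = 8 := by
    rw [(WithLp.linearEquiv 2 ℝ (ℍ[ℝ] × ℍ[ℝ])).finrank_eq]
    simp [Quaternion.finrank_eq_four]
  have h2 : LinearMap.range Octonion.reL = ⊤ := by
    rw [LinearMap.range_eq_top]
    intro r
    exact ⟨WithLp.toLp 2 ((r : ℍ[ℝ]), 0), by simp [Octonion.reL_apply]⟩
  rw [h2, finrank_top, Module.finrank_self, h1] at h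
  change Module.finrank ℝ (LinearMap.ker Octonion.reL) = 7
  omega⟩

namespace Cayley

theorem re_eq_zero (A : Cayley) : (WithLp.fst (A : Octonion)).re = 0 := A.2

/-- The cross product `A × B = (A B - B A) / 2` of imaginary octonions. -/
def cross (A B : Cayley) : Cayley :=
  ⟨(1 / 2 : ℝ) • (Octonion.mul A B - Octonion.mul B A), by
    simp [Octonion.reL_apply, Octonion.mul]; ring⟩

theorem inner_eq (A B : Cayley) : ⟪A, B⟫_ℝ =
      (WithLp.fst (A : Octonion)).imI * (WithLp.fst (B : Octonion)).imI
      + (WithLp.fst (A : Octonion)).imJ * (WithLp.fst (B : Octonion)).imJ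
      + (WithLp.fst (A : Octonion)).imK * (WithLp.fst (B : Octonion)).imK
      + (WithLp.snd (A : Octonion)).re * (WithLp.snd (B : Octonion)).re
      + (WithLp.snd (A : Octonion)).imI * (WithLp.snd (B : Octonion)).imI
      + (WithLp.snd (A : Octonion)).imJ * (WithLp.snd (B : Octonion)).imJ
      + (WithLp.snd (A : Octonion)).imK * (WithLp.snd (B : Octonion)).imK := by
  rw [Submodule.coe_inner, WithLp.prod_inner_apply]
  simp [Quaternion.inner_def, re_eq_zero]
  ring

theorem ext_coords {A B : Cayley}
    (h1 : (WithLp.fst (A : Octonion)).imI = (WithLp.fst (B : Octonion)).imI)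
    (h2 : (WithLp.fst (A : Octonion)).imJ = (WithLp.fst (B : Octonion)).imJ)
    (h3 : (WithLp.fst (A : Octonion)).imK = (WithLp.fst (B : Octonion)).imK)
    (h4 : (WithLp.snd (A : Octonion)).re = (WithLp.snd (B : Octonion)).re)
    (h5 : (WithLp.snd (A : Octonion)).imI = (WithLp.snd (B : Octonion)).imI)
    (h6 : (WithLp.snd (A : Octonion)).imJ = (WithLp.snd (B : Octonion)).imJ)
    (h7 : (WithLp.snd (A : Octonion)).imK = (WithLp.snd (B : Octonion)).imK) : A = B := by
  apply Subtype.ext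
  apply WithLp.ofLp_injective 2
  apply Prod.ext
  · exact QuaternionAlgebra.ext ((re_eq_zero A).trans (re_eq_zero B).symm) h1 h2 h3
  · exact QuaternionAlgebra.ext h4 h5 h6 h7

theorem inner_self_cross (A B : Cayley) : ⟪A, cross A B⟫_ℝ = 0 := by
  rw [inner_eq]
  simp [cross, Octonion.mul, re_eq_zero]
  ring

theorem cross_fst (A B : Cayley) : (WithLp.fst (cross A B : Octonion)) = (1 / 2 : ℝ) •
    ((WithLp.fst (A : Octonion) * WithLp.fst (B : Octonion)
        - star (WithLp.snd (B : Octonion)) * WithLp.snd (A : Octonion))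
      - (WithLp.fst (B : Octonion) * WithLp.fst (A : Octonion)
        - star (WithLp.snd (A : Octonion)) * WithLp.snd (B : Octonion))) := rfl

theorem cross_snd (A B : Cayley) : (WithLp.snd (cross A B : Octonion)) = (1 / 2 : ℝ) •
    ((WithLp.snd (A : Octonion) * star (WithLp.fst (B : Octonion))
        + WithLp.snd (B : Octonion) * WithLp.fst (A : Octonion))
      - (WithLp.snd (B : Octonion) * star (WithLp.fst (A : Octonion))
        + WithLp.snd (A : Octonion) * WithLp.fst (B : Octonion))) := rfl

set_option maxHeartbeats 2000000 in
theorem cross_cross (A B : Cayley) :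
    cross A (cross A B) = ⟪A, B⟫_ℝ • A - ⟪A, A⟫_ℝ • B := by
  have h1 := inner_eq A B
  have h2 := inner_eq A A
  generalize ⟪A, B⟫_ℝ = p at h1 ⊢
  generalize ⟪A, A⟫_ℝ = q at h2 ⊢
  have hA := re_eq_zero A
  have hB := re_eq_zero B
  apply ext_coords <;>
  simp only [cross_fst, cross_snd, Submodule.coe_sub, Submodule.coe_smul, WithLp.sub_fst,
    WithLp.sub_snd, WithLp.smul_fst, WithLp.smul_snd] <;>
  generalize WithLp.fst (A : Octonion) = a at * <;>
  generalize WithLp.snd (A : Octonion) = a' at * <;>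
  generalize WithLp.fst (B : Octonion) = b at * <;>
  generalize WithLp.snd (B : Octonion) = b' at * <;>
  simp [hA, hB, h1, h2] <;> ring

theorem cross_add_left (A B C : Cayley) : cross (A + B) C = cross A C + cross B C := by
  apply Subtype.ext
  simp only [cross, Submodule.coe_add, Octonion.add_mul', Octonion.mul_add']
  module

theorem cross_add_right (A B C : Cayley) : cross A (B + C) = cross A B + cross A C := by
  apply Subtype.ext
  simp only [cross, Submodule.coe_add, Octonion.add_mul', Octonion.mul_add']
  module

theorem cross_smul_left (r : ℝ) (A B : Cayley) : cross (r • A) B = r • cross A B := by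
  apply Subtype.ext
  simp only [cross, Submodule.coe_smul, Octonion.smul_mul', Octonion.mul_smul']
  module

theorem cross_smul_right (r : ℝ) (A B : Cayley) : cross A (r • B) = r • cross A B := by
  apply Subtype.ext
  simp only [cross, Submodule.coe_smul, Octonion.smul_mul', Octonion.mul_smul']
  module

/-- The cross product as a bilinear map. -/
def crossL : Cayley →ₗ[ℝ] Cayley →ₗ[ℝ] Cayley :=
  LinearMap.mk₂ ℝ cross cross_add_left cross_smul_left cross_add_right cross_smul_right

theorem crossL_apply (A B : Cayley) : crossL A B = cross A B := rfl

theorem cross_sub_left (A B C : Cayley) : cross (A - B) C = cross A C - cross B C := by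
  simp only [← crossL_apply, map_sub, LinearMap.sub_apply]

theorem cross_sub_right (A B C : Cayley) : cross A (B - C) = cross A B - cross A C := by
  simp only [← crossL_apply, map_sub]

theorem cross_zero_left (B : Cayley) : cross 0 B = 0 := by
  simp only [← crossL_apply, map_zero, LinearMap.zero_apply]

theorem cross_zero_right (A : Cayley) : cross A 0 = 0 := by
  simp only [← crossL_apply, map_zero]

end Cayley

open Cayley (cross)

/-! ### The group `G₂` and its Lie algebra -/

/-- The group `G₂` of automorphisms of the cross product, as a subgroup of `GL(𝒴)` (with the
subspace topology). -/
def G2 : Subgroup (Cayley →L[ℝ] Cayley)ˣ where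
  carrier := {g | ∀ A B, g.1 (cross A B) = cross (g.1 A) (g.1 B)}
  mul_mem' {g h} hg hh A B := by
    simp only [Set.mem_ofPred_eq] at hg hh
    simp [hg, hh]
  one_mem' A B := by simp
  inv_mem' {g} hg A B := by
    have e (C : Cayley) : g.1 ((g⁻¹).1 C) = C := by
      rw [← mul_apply_eq_comp, Units.mul_inv, one_apply_eq_self]
    have e' (C : Cayley) : (g⁻¹).1 (g.1 C) = C := by
      rw [← mul_apply_eq_comp, Units.inv_mul, one_apply_eq_self]
    have := hg ((g⁻¹).1 A) ((g⁻¹).1 B)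
    rw [e, e] at this
    rw [← this, e']

namespace G2

/-- The linear action of `G₂` on `𝒴`. -/
def toLin (g : G2) : Cayley →L[ℝ] Cayley := (g : (Cayley →L[ℝ] Cayley)ˣ).1

theorem toLin_cross (g : G2) (A B : Cayley) :
    G2.toLin g (cross A B) = cross (G2.toLin g A) (G2.toLin g B) := g.2 A B

theorem toLin_one : toLin 1 = 1 := rfl

theorem toLin_mul (g h : G2) : toLin (g * h) = toLin g * toLin h := rfl

theorem toLin_mul_inv (g : G2) : G2.toLin g * G2.toLin (g⁻¹) = 1 := by
  rw [← toLin_mul, mul_inv_cancel, toLin_one]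

theorem toLin_inv_mul (g : G2) : G2.toLin (g⁻¹) * G2.toLin g = 1 := by
  rw [← toLin_mul, inv_mul_cancel, toLin_one]

theorem toLin_inv_apply (g : G2) (A : Cayley) : G2.toLin (g⁻¹) (G2.toLin g A) = A := by
  rw [← mul_apply_eq_comp, toLin_inv_mul, one_apply_eq_self]

theorem toLin_injective (g : G2) : Function.Injective (G2.toLin g) :=
  Function.LeftInverse.injective (G2.toLin_inv_apply g)

/-- `G₂` acts by isometries. -/
theorem norm_toLin (g : G2) (A : Cayley) : ‖G2.toLin g A‖ = ‖A‖ := by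
  by_cases hA : A = 0
  · simp [hA]
  obtain ⟨B, hB⟩ : ∃ B : Cayley, B ∉ Submodule.span ℝ {A} := by
    by_contra! h
    have h1 : Submodule.span ℝ {A} = ⊤ := by
      ext x; simp [h x]
    have h2 := finrank_span_singleton (K := ℝ) hA
    rw [h1, finrank_top, Fact.out (p := Module.finrank ℝ Cayley = 6 + 1)] at h2
    omega
  have h := congrArg (G2.toLin g) (Cayley.cross_cross A B)
  rw [toLin_cross, toLin_cross, Cayley.cross_cross, ← sub_eq_zero] at h
  simp only [map_sub, map_smul] at h
  have h' : (⟪G2.toLin g A, G2.toLin g B⟫_ℝ - ⟪A, B⟫_ℝ) • A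
      = (⟪G2.toLin g A, G2.toLin g A⟫_ℝ - ⟪A, A⟫_ℝ) • B := by
    apply G2.toLin_injective g
    simp only [map_smul]
    rw [← sub_eq_zero, ← h]
    module
  have h0 : ⟪G2.toLin g A, G2.toLin g A⟫_ℝ - ⟪A, A⟫_ℝ = 0 := by
    by_contra hne
    apply hB
    rw [Submodule.mem_span_singleton]
    refine ⟨(⟪G2.toLin g A, G2.toLin g A⟫_ℝ - ⟪A, A⟫_ℝ)⁻¹
      * (⟪G2.toLin g A, G2.toLin g B⟫_ℝ - ⟪A, B⟫_ℝ), ?_⟩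
    rw [mul_smul, h', smul_smul, inv_mul_cancel₀ hne, one_smul]
  rw [real_inner_self_eq_norm_sq, real_inner_self_eq_norm_sq, sub_eq_zero] at h0
  exact (sq_eq_sq₀ (norm_nonneg _) (norm_nonneg _)).1 h0

end G2

/-- The Lie algebra of `G₂`: the derivations of the cross product, with the commutator bracket. -/
def g2 : LieSubalgebra ℝ (Cayley →L[ℝ] Cayley) where
  carrier := {D | ∀ A B, D (cross A B) = cross (D A) B + cross A (D B)}
  add_mem' {D E} hD hE A B := by
    simp only [Set.mem_ofPred_eq] at hD hE
    simp only [add_apply, hD, hE, Cayley.cross_add_left,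
      Cayley.cross_add_right]
    abel
  zero_mem' A B := by
    simp [Cayley.cross_zero_left, Cayley.cross_zero_right]
  smul_mem' r D hD A B := by
    simp only [Set.mem_ofPred_eq] at hD
    simp only [smul_apply, hD, Cayley.cross_smul_left,
      Cayley.cross_smul_right, smul_add]
  lie_mem' {D E} hD hE A B := by
    have hD' : ∀ A B, D (cross A B) = cross (D A) B + cross A (D B) := hD
    have hE' : ∀ A B, E (cross A B) = cross (E A) B + cross A (E B) := hE
    simp only [Ring.lie_def, sub_apply, mul_apply_eq_comp, hD',
      hE', map_add, Cayley.cross_sub_left, Cayley.cross_sub_right]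
    abel

theorem exp_smul_mul_exp_neg_smul {E : Type*} [NormedAddCommGroup E] [NormedSpace ℝ E]
    [CompleteSpace E] (D : E →L[ℝ] E) (t : ℝ) :
    NormedSpace.exp (t • D) * NormedSpace.exp (-t • D) = 1 := by
  let _ : NormedAlgebra ℚ (E →L[ℝ] E) := NormedAlgebra.restrictScalars ℚ ℝ _
  rw [← NormedSpace.exp_add_of_commute (((Commute.refl D).smul_left _).smul_right _), ← add_smul,
    add_neg_cancel, zero_smul, NormedSpace.exp_zero]

/-- `D` is a derivation of a bilinear product if and only if all `exp (t D)` are automorphisms. -/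
theorem derivation_iff_exp {E : Type*} [NormedAddCommGroup E] [NormedSpace ℝ E] [CompleteSpace E]
    (b : E →L[ℝ] E →L[ℝ] E) (D : E →L[ℝ] E) :
    (∀ A B, D (b A B) = b (D A) B + b A (D B)) ↔ ∀ (t : ℝ) (A B : E),
      NormedSpace.exp (t • D) (b A B)
        = b (NormedSpace.exp (t • D) A) (NormedSpace.exp (t • D) B) := by
  have hd (t : ℝ) : HasDerivAt (fun u : ℝ => NormedSpace.exp (u • D))
      (NormedSpace.exp (t • D) * D) t := hasDerivAt_exp_smul_const D t
  have hd' (t : ℝ) (A : E) : HasDerivAt (fun u : ℝ => NormedSpace.exp (u • D) A)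
      (NormedSpace.exp (t • D) (D A)) t := by
    simpa using (hd t).clm_apply (hasDerivAt_const t A)
  have hc (t : ℝ) (A B : E) : HasDerivAt
      (fun u : ℝ => b (NormedSpace.exp (u • D) A) (NormedSpace.exp (u • D) B))
      (b (NormedSpace.exp (t • D) (D A)) (NormedSpace.exp (t • D) B)
        + b (NormedSpace.exp (t • D) A) (NormedSpace.exp (t • D) (D B))) t :=
    (b.hasFDerivAt.comp_hasDerivAt t (hd' t A)).clm_apply (hd' t B)
  constructor
  · intro hD t A B
    have hcomm (t : ℝ) (A : E) :
        NormedSpace.exp (t • D) (D A) = D (NormedSpace.exp (t • D) A) := by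
      have : Commute (NormedSpace.exp (t • D)) D :=
        ((Commute.refl D).smul_left t).exp_left
      exact congrArg (fun L : E →L[ℝ] E => L A) this.eq
    have hconst : NormedSpace.exp (-t • D)
        (b (NormedSpace.exp (t • D) A) (NormedSpace.exp (t • D) B)) = b A B := by
      have hder (t : ℝ) : HasDerivAt (fun u : ℝ => NormedSpace.exp (-u • D)
          (b (NormedSpace.exp (u • D) A) (NormedSpace.exp (u • D) B))) 0 t := by
        have h1 : HasDerivAt (fun u : ℝ => NormedSpace.exp (-u • D))
            (-(NormedSpace.exp (-t • D) * D)) t := by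
          simpa [Function.comp_def] using (hd (-t)).scomp t (hasDerivAt_neg t)
        have := h1.clm_apply (hc t A B)
        convert! this using 1
        rw [hcomm t A, hcomm t B, ← hD]
        simp
      have := is_const_of_deriv_eq_zero (fun s => (hder s).differentiableAt)
        (fun s => (hder s).deriv) t 0
      simpa using this
    rw [← hconst, ← mul_apply_eq_comp, exp_smul_mul_exp_neg_smul, one_apply_eq_self]
  · intro h A B
    have h1 := hd' 0 (b A B)
    rw [show (fun u : ℝ => NormedSpace.exp (u • D) (b A B))
        = fun u : ℝ => b (NormedSpace.exp (u • D) A) (NormedSpace.exp (u • D) B) from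
      funext fun u => h u A B] at h1
    simpa using h1.unique (hc 0 A B)

/-- `g2` is the Lie algebra of the closed linear group `G₂`, i.e. it consists of the `D` all of
whose one-parameter groups `exp (t D)` lie in `G₂`. -/
theorem mem_g2_iff_exp (D : Cayley →L[ℝ] Cayley) :
    D ∈ g2 ↔ ∀ t : ℝ, ∃ g : G2, G2.toLin g = NormedSpace.exp (t • D) := by
  let b : Cayley →L[ℝ] Cayley →L[ℝ] Cayley :=
    LinearMap.toContinuousLinearMap
      ((LinearMap.toContinuousLinearMap : (Cayley →ₗ[ℝ] Cayley) ≃ₗ[ℝ] _).toLinearMap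
        ∘ₗ Cayley.crossL)
  refine Iff.trans (derivation_iff_exp b D) (forall_congr' fun t => ⟨fun h => ?_, ?_⟩)
  · have hinv := exp_smul_mul_exp_neg_smul D t
    have hinv' := exp_smul_mul_exp_neg_smul D (-t)
    rw [neg_neg] at hinv'
    exact ⟨⟨⟨NormedSpace.exp (t • D), NormedSpace.exp (-t • D), hinv, hinv'⟩, h⟩, rfl⟩
  · rintro ⟨g, hg⟩ A B
    rw [← hg]
    exact G2.toLin_cross g A B

/-- The adjoint action of `G₂` on its Lie algebra. -/
def G2.Ad (g : G2) (D : g2) : g2 :=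
  ⟨G2.toLin g * D.1 * G2.toLin (g⁻¹), fun A B => by
    have hD : ∀ A B, D.1 (cross A B) = cross (D.1 A) B + cross A (D.1 B) := D.2
    have e (C : Cayley) : G2.toLin g (G2.toLin (g⁻¹) C) = C := by
      rw [← mul_apply_eq_comp, G2.toLin_mul_inv, one_apply_eq_self]
    simp only [mul_apply_eq_comp, G2.toLin_cross, hD, map_add, e]⟩

/-! ### The round sphere `S⁶` as a homogeneous space of `G₂` -/

/-- The unit sphere in the Cayley space. -/
abbrev S6 : Type := Metric.sphere (0 : Cayley) 1

/-- The action of `G₂` on `S⁶`. -/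
instance : MulAction G2 S6 where
  smul g x := ⟨G2.toLin g x, by
    rw [mem_sphere_zero_iff_norm, G2.norm_toLin, norm_eq_of_mem_sphere x]⟩
  one_smul _ := rfl
  mul_smul _ _ _ := rfl

theorem G2.coe_smul (g : G2) (x : S6) : ((g • x : S6) : Cayley) = G2.toLin g x := rfl

/-- The Lie algebra of the isotropy group of `o`. -/
def isotropyAlgebra (o : S6) : Submodule ℝ g2 where
  carrier := {D | D.1 o = 0}
  add_mem' {D E} hD hE := by
    simp only [Set.mem_ofPred_eq] at hD hE
    simp [hD, hE]
  zero_mem' := by simp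
  smul_mem' r D hD := by
    simp only [Set.mem_ofPred_eq] at hD
    simp [hD]

/-- `m` is a reductive complement at `o`: `g2 = h ⊕ m` with `h` the isotropy algebra of `o`, and
`m` is invariant under `Ad` of the isotropy group. -/
structure IsReductiveComplement (o : S6) (m : Submodule ℝ g2) : Prop where
  isCompl : IsCompl (isotropyAlgebra o) m
  ad_mem : ∀ k ∈ MulAction.stabilizer G2 o, ∀ D ∈ m, G2.Ad k D ∈ m

/-- The bracket `[X, Y]_m`, i.e. the `m`-component of `[X, Y]` with respect to `g2 = h ⊕ m`. -/
def bracketM {o : S6} {m : Submodule ℝ g2} (hm : IsReductiveComplement o m) (X Y : g2) : g2 :=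
  m.projection (isotropyAlgebra o) hm.isCompl.symm ⁅X, Y⁆

/-- The inner product on `m` that defines the round metric of `S⁶`: it is transported from
`T_o S⁶` by the differential `X ↦ X o` of the orbit map. -/
def innerM (o : S6) (X Y : g2) : ℝ := ⟪X.1 o, Y.1 o⟫_ℝ

/-- The reductive complement `m` makes `S⁶` a naturally reductive space. -/
structure IsNaturallyReductive (o : S6) (m : Submodule ℝ g2) : Prop where
  reductive : IsReductiveComplement o m
  skew : ∀ X ∈ m, ∀ Y ∈ m, ∀ Z ∈ m,
    innerM o (bracketM reductive X Y) Z = - innerM o (bracketM reductive X Z) Y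

/-! ### Metric, almost complex structure and connections on `S⁶` -/

namespace S6

/-- The differential of the inclusion `S⁶ → 𝒴`; it identifies `T_x S⁶` with `x^⊥`. -/
def incl (x : S6) : TangentSpace (𝓡 6) x →L[ℝ] Cayley :=
  mvfderiv (𝓡 6) (Subtype.val : S6 → Cayley) x

theorem exists_incl_eq (x : S6) (w : Cayley) (hw : ⟪(x : Cayley), w⟫_ℝ = 0) :
    ∃ v, incl x v = w := by
  have h : w ∈ (mvfderiv (𝓡 6) (Subtype.val : S6 → Cayley) x).range := by
    rw [range_mvfderiv_subtypeVal]
    exact (Submodule.mem_orthogonal_singleton_iff_inner_right).2 hw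
  exact h

/-- The round metric. -/
def metric (x : S6) (u v : TangentSpace (𝓡 6) x) : ℝ := ⟪incl x u, incl x v⟫_ℝ

/-- The unit normal vector field of `S⁶` (pointing outwards). -/
def normal (x : S6) : Cayley := x

/-- The almost complex structure `J X = N × X`. -/
def J (x : S6) (v : TangentSpace (𝓡 6) x) : TangentSpace (𝓡 6) x :=
  (exists_incl_eq x (cross (normal x) (incl x v)) (Cayley.inner_self_cross _ _)).choose

theorem incl_J (x : S6) (v : TangentSpace (𝓡 6) x) :
    incl x (J x v) = cross (normal x) (incl x v) :=
  (exists_incl_eq x (cross (normal x) (incl x v)) (Cayley.inner_self_cross _ _)).choose_spec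

/-- The formula `J W = N × W`, for all vectors `W` of `𝒴` at a point of `S⁶`. -/
def ambientJ (x : S6) (W : Cayley) : Cayley := cross (normal x) W

/-- Affine connections on `S⁶`; `∇ Y x (X x)` is `(∇_X Y)(x)`. -/
abbrev Connection : Type :=
  CovariantDerivative (𝓡 6) (EuclideanSpace ℝ (Fin 6)) (TangentSpace (𝓡 6) : S6 → Type)

/-- Differentiability of a vector field at a point. -/
def DiffAt (Y : Π y : S6, TangentSpace (𝓡 6) y) (x : S6) : Prop :=
  MDifferentiableAt (𝓡 6) ((𝓡 6).prod 𝓘(ℝ, EuclideanSpace ℝ (Fin 6)))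
    (fun y => (⟨y, Y y⟩ : TangentBundle (𝓡 6) S6)) x

/-- The torsion as a `(0,3)`-tensor, `T(X, Y, Z) = ⟨∇_X Y - ∇_Y X - [X, Y], Z⟩`. -/
def torsion3 (D : Connection) (x : S6) (u v w : TangentSpace (𝓡 6) x) : ℝ :=
  metric x (D.torsion x u v) w

/-- `∇ g = 0`. -/
def IsMetric (D : Connection) : Prop :=
  ∀ (x : S6) (X : TangentSpace (𝓡 6) x) (Y Z : Π y : S6, TangentSpace (𝓡 6) y),
    DiffAt Y x → DiffAt Z x →
      mvfderiv (𝓡 6) (fun y : S6 => metric y (Y y) (Z y)) x X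
        = metric x (D Y x X) (Z x) + metric x (Y x) (D Z x X)

/-- `∇ J = 0`. -/
def PreservesJ (D : Connection) : Prop :=
  ∀ (x : S6) (X : TangentSpace (𝓡 6) x) (Y : Π y : S6, TangentSpace (𝓡 6) y),
    DiffAt Y x → D (fun y => J y (Y y)) x X = J x (D Y x X)

/-- The torsion is totally skew symmetric (it is always skew in the first two arguments). -/
def HasSkewTorsion (D : Connection) : Prop :=
  ∀ (x : S6) (u v w : TangentSpace (𝓡 6) x), torsion3 D x u v w = - torsion3 D x u w v

/-- The characteristic connection of `(S⁶, g, J)`: metric, preserving `J`, and with totally skew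
symmetric torsion. -/
structure IsCharacteristicConnection (D : Connection) : Prop where
  metric : IsMetric D
  preservesJ : PreservesJ D
  skew : HasSkewTorsion D

/-- The canonical connection of the homogeneous space with respect to `g2 = h ⊕ m`: the metric
connection whose torsion is the `G₂`-invariant tensor on `S⁶` that is given on `m = T_o S⁶` by
`T(X, Y, Z) = - ⟨[X, Y]_m, Z⟩`. Here `X ∈ m` corresponds to the tangent vector `X o` at `o`, and
`g ∈ G₂` carries it to the tangent vector `g (X o)` at `g o`. -/
structure IsCanonicalConnection {o : S6} {m : Submodule ℝ g2} (hm : IsReductiveComplement o m)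
    (D : Connection) : Prop where
  metric : IsMetric D
  torsion : ∀ (g : G2), ∀ X ∈ m, ∀ Y ∈ m, ∀ Z ∈ m, ∀ u v w : TangentSpace (𝓡 6) (g • o),
    incl (g • o) u = G2.toLin g (X.1 o) → incl (g • o) v = G2.toLin g (Y.1 o) →
    incl (g • o) w = G2.toLin g (Z.1 o) →
      torsion3 D (g • o) u v w = - innerM o (bracketM hm X Y) Z

end S6

end

/-!
Everything is computed with the cross product of `𝒴`. The identity `A × (A × B) = ⟨A, B⟩ A - ⟨A,
A⟩ B` and its polarization show that `⟨x × (X × Y), Z⟩` is totally skew for `X, Y, Z` in `x^⊥ =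
T_x S⁶` (`Cayley.inner_cross_cross_skew`), and that `X × Y` is complex antilinear in both
arguments up to a multiple of `x`.

*Homogeneous space.* For unit `o` and `v ⊥ o`, a multiple of the inner derivation of the octonions
defined by `v` and `o` is an element `g2.transvection o v` of `g2` whose one-parameter group moves
`o` along the great circle in direction `v`; so `G₂` is transitive, and by compactness `G₂ / H →
S⁶` is a homeomorphism. In the decomposition `𝒴 = ℝ i ⊕ ℂ³` the cross product is given by the
hermitian form and the complex cross product of `ℂ³`, which identifies the isotropy group of `i`
with `SU(3)` (`SU3.stabilizerEquiv`).

*Reductive complements.* The transvections at `o` form a reductive complement, and it is the only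
one (`IsReductiveComplement.eq_transvection`): the centre of `SU(3)` contains a `k` of order
three, and `1 + Ad k + (Ad k)²` vanishes on a complement, whereas it is three times the identity
on the isotropy algebra. It follows that `[X, Y]_m` has the value `o × (X(o) × Y(o))` at `o`, and
the total skewness above is the natural reductivity.

*Connections.* Regard vector fields as functions with values in `𝒴`. The connection `∇_X Y =
dY(X)^⊤ - x × (X × Y) / 2` is smooth, metric, preserves `J` and has the torsion `-x × (X × Y)`;
for the latter one needs that the Lie bracket is the commutator of derivatives in the ambient
space (`S6.incl_mlieBracket`). Any other characteristic connection differs from it by a tensor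
`a(X, Y, Z)` that is totally skew with `a(X, JY, Z) = -a(X, Y, JZ)`, hence zero
(`S6.IsCharacteristicConnection.eq`). Two metric connections with the same torsion agree as well
(`S6.eq_of_isMetric_of_torsion3_eq`), and by transitivity and the formula for `[X, Y]_m` the
torsion of the canonical connection is the one above, which gives the comparison of both
connections. Since a covariant derivative is constrained only on differentiable fields, all
equalities of connections are statements about such fields.
-/

noncomputable section

open Cayley (cross)

/-! ### Identities for the cross product -/

namespace Cayley

theorem cross_self (A : Cayley) : cross A A = 0 := by
  apply Subtype.ext; simp [cross]

theorem cross_swap (A B : Cayley) : cross A B = -cross B A := by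
  apply Subtype.ext
  simp only [cross, Submodule.coe_neg]
  module

/-- `A × ·` is skew. -/
theorem inner_cross_left (A B C : Cayley) : ⟪cross A B, C⟫_ℝ = -⟪B, cross A C⟫_ℝ := by
  have h := inner_self_cross (B + C) A
  rw [cross_swap (B + C) A, cross_add_right, inner_neg_right, inner_add_left, inner_add_right,
    inner_add_right, cross_swap A B, cross_swap A C, inner_neg_right, inner_neg_right,
    inner_neg_right, inner_neg_right, inner_self_cross, inner_self_cross] at h
  rw [cross_swap A B, cross_swap A C, inner_neg_left, inner_neg_right, real_inner_comm]
  linarith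

/-- The polarization of `cross_cross`. -/
theorem cross_cross_polar (A B C : Cayley) :
    cross A (cross B C) + cross B (cross A C)
      = ⟪A, C⟫_ℝ • B + ⟪B, C⟫_ℝ • A - (2 * ⟪A, B⟫_ℝ) • C := by
  have h := cross_cross (A + B) C
  simp only [cross_add_left, cross_add_right, cross_cross, inner_add_left, inner_add_right] at h
  rw [real_inner_comm A B] at h
  rw [← sub_eq_zero] at h ⊢
  rw [← h]
  module

theorem cross_fst_imI (A B : Cayley) : (WithLp.fst (cross A B : Octonion)).imI =
      (WithLp.fst (A : Octonion)).imJ * (WithLp.fst (B : Octonion)).imK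
        - (WithLp.fst (A : Octonion)).imK * (WithLp.fst (B : Octonion)).imJ
      - (WithLp.snd (B : Octonion)).re * (WithLp.snd (A : Octonion)).imI
        + (WithLp.snd (A : Octonion)).re * (WithLp.snd (B : Octonion)).imI
      + (WithLp.snd (B : Octonion)).imJ * (WithLp.snd (A : Octonion)).imK
        - (WithLp.snd (B : Octonion)).imK * (WithLp.snd (A : Octonion)).imJ := by
  simp [cross_fst, re_eq_zero]
  ring

theorem cross_fst_imJ (A B : Cayley) : (WithLp.fst (cross A B : Octonion)).imJ =
      (WithLp.fst (A : Octonion)).imK * (WithLp.fst (B : Octonion)).imI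
        - (WithLp.fst (A : Octonion)).imI * (WithLp.fst (B : Octonion)).imK
      - (WithLp.snd (B : Octonion)).re * (WithLp.snd (A : Octonion)).imJ
        + (WithLp.snd (A : Octonion)).re * (WithLp.snd (B : Octonion)).imJ
      + (WithLp.snd (B : Octonion)).imK * (WithLp.snd (A : Octonion)).imI
        - (WithLp.snd (B : Octonion)).imI * (WithLp.snd (A : Octonion)).imK := by
  simp [cross_fst, re_eq_zero]
  ring

theorem cross_fst_imK (A B : Cayley) : (WithLp.fst (cross A B : Octonion)).imK =
      (WithLp.fst (A : Octonion)).imI * (WithLp.fst (B : Octonion)).imJ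
        - (WithLp.fst (A : Octonion)).imJ * (WithLp.fst (B : Octonion)).imI
      - (WithLp.snd (B : Octonion)).re * (WithLp.snd (A : Octonion)).imK
        + (WithLp.snd (A : Octonion)).re * (WithLp.snd (B : Octonion)).imK
      + (WithLp.snd (B : Octonion)).imI * (WithLp.snd (A : Octonion)).imJ
        - (WithLp.snd (B : Octonion)).imJ * (WithLp.snd (A : Octonion)).imI := by
  simp [cross_fst, re_eq_zero]
  ring

theorem cross_snd_re (A B : Cayley) : (WithLp.snd (cross A B : Octonion)).re =
      (WithLp.snd (A : Octonion)).imI * (WithLp.fst (B : Octonion)).imI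
        + (WithLp.snd (A : Octonion)).imJ * (WithLp.fst (B : Octonion)).imJ
        + (WithLp.snd (A : Octonion)).imK * (WithLp.fst (B : Octonion)).imK
      - (WithLp.snd (B : Octonion)).imI * (WithLp.fst (A : Octonion)).imI
        - (WithLp.snd (B : Octonion)).imJ * (WithLp.fst (A : Octonion)).imJ
      - (WithLp.snd (B : Octonion)).imK * (WithLp.fst (A : Octonion)).imK := by
  simp [cross_snd, re_eq_zero]
  ring

theorem cross_snd_imI (A B : Cayley) : (WithLp.snd (cross A B : Octonion)).imI =
      (WithLp.snd (B : Octonion)).re * (WithLp.fst (A : Octonion)).imI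
        - (WithLp.snd (A : Octonion)).re * (WithLp.fst (B : Octonion)).imI
      + (WithLp.snd (B : Octonion)).imJ * (WithLp.fst (A : Octonion)).imK
        - (WithLp.snd (B : Octonion)).imK * (WithLp.fst (A : Octonion)).imJ
      - (WithLp.snd (A : Octonion)).imJ * (WithLp.fst (B : Octonion)).imK
        + (WithLp.snd (A : Octonion)).imK * (WithLp.fst (B : Octonion)).imJ := by
  simp [cross_snd, re_eq_zero]
  ring

theorem cross_snd_imJ (A B : Cayley) : (WithLp.snd (cross A B : Octonion)).imJ =
      (WithLp.snd (B : Octonion)).re * (WithLp.fst (A : Octonion)).imJ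
        - (WithLp.snd (A : Octonion)).re * (WithLp.fst (B : Octonion)).imJ
      + (WithLp.snd (B : Octonion)).imK * (WithLp.fst (A : Octonion)).imI
        - (WithLp.snd (B : Octonion)).imI * (WithLp.fst (A : Octonion)).imK
      - (WithLp.snd (A : Octonion)).imK * (WithLp.fst (B : Octonion)).imI
        + (WithLp.snd (A : Octonion)).imI * (WithLp.fst (B : Octonion)).imK := by
  simp [cross_snd, re_eq_zero]
  ring

theorem cross_snd_imK (A B : Cayley) : (WithLp.snd (cross A B : Octonion)).imK =
      (WithLp.snd (B : Octonion)).re * (WithLp.fst (A : Octonion)).imK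
        - (WithLp.snd (A : Octonion)).re * (WithLp.fst (B : Octonion)).imK
      + (WithLp.snd (B : Octonion)).imI * (WithLp.fst (A : Octonion)).imJ
        - (WithLp.snd (B : Octonion)).imJ * (WithLp.fst (A : Octonion)).imI
      - (WithLp.snd (A : Octonion)).imI * (WithLp.fst (B : Octonion)).imJ
        + (WithLp.snd (A : Octonion)).imJ * (WithLp.fst (B : Octonion)).imI := by
  simp [cross_snd, re_eq_zero]
  ring

set_option maxHeartbeats 4000000 in
/-- The map `X ↦ (A × B) × X + 3 A × (B × X) + 3 ⟨A, B⟩ X - 3 ⟨B, X⟩ A` is a derivation of the cross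
product. In each of the seven coordinates this is a polynomial identity. -/
theorem innerDer_cross (A B X Y : Cayley) :
    cross (cross A B) (cross X Y) + (3 : ℝ) • cross A (cross B (cross X Y))
        + (3 * ⟪A, B⟫_ℝ) • cross X Y - (3 * ⟪B, cross X Y⟫_ℝ) • A
      = cross (cross (cross A B) X + (3 : ℝ) • cross A (cross B X) + (3 * ⟪A, B⟫_ℝ) • X
          - (3 * ⟪B, X⟫_ℝ) • A) Y
        + cross X (cross (cross A B) Y + (3 : ℝ) • cross A (cross B Y) + (3 * ⟪A, B⟫_ℝ) • Y
          - (3 * ⟪B, Y⟫_ℝ) • A) := by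
  apply ext_coords <;>
  simp only [inner_eq, cross_fst_imI, cross_fst_imJ, cross_fst_imK, cross_snd_re, cross_snd_imI,
    cross_snd_imJ, cross_snd_imK, Submodule.coe_sub, Submodule.coe_add, Submodule.coe_smul,
    WithLp.sub_fst, WithLp.sub_snd, WithLp.smul_fst, WithLp.smul_snd, WithLp.add_fst,
    WithLp.add_snd, Quaternion.imI_add, Quaternion.imJ_add, Quaternion.imK_add, Quaternion.re_add,
    Quaternion.imI_sub, Quaternion.imJ_sub, Quaternion.imK_sub, Quaternion.re_sub,
    Quaternion.imI_smul, Quaternion.imJ_smul, Quaternion.imK_smul, Quaternion.re_smul,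
    smul_eq_mul] <;> ring

end Cayley

/-! ### Derivations and transvections -/

-- Shortcut instances: without them the search through the subobjects of the operators is slow.
local instance : AddCommGroup Cayley := inferInstance
local instance : Module ℝ Cayley := inferInstance
local instance : NormedSpace ℝ Cayley := inferInstance
local instance : AddCommGroup (Cayley →L[ℝ] Cayley) := inferInstance
set_option synthInstance.maxHeartbeats 200000 in
local instance : Module ℝ (Cayley →L[ℝ] Cayley) := inferInstance
set_option synthInstance.maxHeartbeats 200000 in
local instance : SMulWithZero ℝ (Cayley →L[ℝ] Cayley) := inferInstance
local instance : AddCommGroup g2 := inferInstance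
set_option synthInstance.maxHeartbeats 200000 in
local instance : Module ℝ g2 := inferInstance
local instance : SMul ℝ g2 := (inferInstance : Module ℝ g2).toSMul

namespace g2

theorem coe_add (D E : g2) : (D + E).1 = D.1 + E.1 := rfl

theorem coe_smul (r : ℝ) (D : g2) : (r • D).1 = r • D.1 := rfl

theorem apply_cross (D : g2) (A B : Cayley) :
    D.1 (cross A B) = cross (D.1 A) B + cross A (D.1 B) := D.2 A B

/-- Derivations of the cross product are skew, because `G₂` acts by isometries. -/
theorem inner_apply_self (D : g2) (A : Cayley) : ⟪D.1 A, A⟫_ℝ = 0 := by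
  have hd : HasDerivAt (fun u : ℝ => NormedSpace.exp (u • D.1) A) (D.1 A) 0 := by
    simpa using (hasDerivAt_exp_smul_const D.1 (0 : ℝ)).clm_apply (hasDerivAt_const 0 A)
  have hc (t : ℝ) : ⟪NormedSpace.exp (t • D.1) A, NormedSpace.exp (t • D.1) A⟫_ℝ = ⟪A, A⟫_ℝ := by
    obtain ⟨g, hg⟩ := (mem_g2_iff_exp D.1).1 D.2 t
    rw [← hg, real_inner_self_eq_norm_sq, real_inner_self_eq_norm_sq, G2.norm_toLin]
  have h := hd.inner ℝ hd
  simp only [hc] at h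
  have h' := h.unique (hasDerivAt_const 0 _)
  simp only [zero_smul, NormedSpace.exp_zero, one_apply_eq_self] at h'
  rw [real_inner_comm A (D.1 A)] at h'
  rw [real_inner_comm]
  exact add_self_eq_zero.1 h'

theorem inner_apply_left (D : g2) (A B : Cayley) : ⟪D.1 A, B⟫_ℝ = -⟪A, D.1 B⟫_ℝ := by
  have h := inner_apply_self D (A + B)
  simp only [map_add, inner_add_left, inner_add_right, inner_apply_self] at h
  linarith [real_inner_comm A (D.1 B)]

/-- The inner derivation `X ↦ [[A, B], X] - 3 ((A B) X - A (B X))` of the octonions defined by two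
imaginary octonions, restricted to `𝒴` and expressed by the cross product. -/
def innerDer (A B : Cayley) : g2 :=
  ⟨LinearMap.toContinuousLinearMap (Cayley.crossL (cross A B)
      + (3 : ℝ) • (Cayley.crossL A ∘ₗ Cayley.crossL B) + (3 * ⟪A, B⟫_ℝ) • LinearMap.id
      - (3 : ℝ) • (innerₛₗ ℝ B).smulRight A), fun X Y => by
    simpa [Cayley.crossL_apply, mul_smul] using Cayley.innerDer_cross A B X Y⟩

theorem innerDer_apply (A B X : Cayley) : (innerDer A B).1 X =
    cross (cross A B) X + (3 : ℝ) • cross A (cross B X) + (3 * ⟪A, B⟫_ℝ) • X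
      - (3 * ⟪B, X⟫_ℝ) • A := by
  simp [innerDer, Cayley.crossL_apply, mul_smul]

/-- For a unit vector `o` and `v` orthogonal to it, the infinitesimal transvection in `g2` with
value `v` at `o`. For arbitrary `o` and `v` it is the inner derivation defined by `v` and `o`,
normalized by the factor `-1 / 4`. -/
def transvection (o : Cayley) : Cayley →ₗ[ℝ] g2 where
  toFun v := (-1 / 4 : ℝ) • innerDer v o
  map_add' u v := by
    ext1; ext1 x
    simp only [coe_smul, coe_add, smul_apply, add_apply,
      innerDer_apply, Cayley.cross_add_left, inner_add_left]
    module
  map_smul' r v := by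
    ext1; ext1 x
    simp only [coe_smul, smul_apply,
      innerDer_apply, Cayley.cross_smul_left, real_inner_smul_left, RingHom.id_apply]
    module

theorem transvection_apply (o v x : Cayley) : (transvection o v).1 x = (-1 / 4 : ℝ) •
    (cross (cross v o) x + (3 : ℝ) • cross v (cross o x) + (3 * ⟪v, o⟫_ℝ) • x
      - (3 * ⟪o, x⟫_ℝ) • v) := by
  rw [← innerDer_apply]; rfl

theorem transvection_base {o : Cayley} (ho : ⟪o, o⟫_ℝ = 1) (v : Cayley) :
    (transvection o v).1 o = v - ⟪o, v⟫_ℝ • o := by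
  rw [transvection_apply, Cayley.cross_self, Cayley.cross_zero_right, Cayley.cross_swap v o,
    Cayley.cross_swap _ o, ← neg_one_smul ℝ (cross o v), Cayley.cross_smul_right,
    Cayley.cross_cross, ho, real_inner_comm o v]
  module

theorem transvection_apply_tangent {o v x : Cayley} (hv : ⟪o, v⟫_ℝ = 0) (hx : ⟪o, x⟫_ℝ = 0) :
    (transvection o v).1 x = (1 / 2 : ℝ) • cross o (cross v x) - ⟪v, x⟫_ℝ • o := by
  have h1 := Cayley.cross_cross_polar o x v
  have h2 := Cayley.cross_cross_polar o v x
  rw [hv, hx, Cayley.cross_swap x v, ← neg_one_smul ℝ (cross v x), Cayley.cross_smul_right,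
    real_inner_comm v x] at h1
  rw [hv, hx] at h2
  have h1' : cross x (cross o v) = ⟪v, x⟫_ℝ • o + cross o (cross v x) := by
    rw [← sub_eq_zero] at h1 ⊢
    rw [← h1]
    module
  rw [transvection_apply, Cayley.cross_swap v o, ← neg_one_smul ℝ (cross o v),
    Cayley.cross_smul_left, Cayley.cross_swap _ x, hx, real_inner_comm o v, hv,
    h1', eq_sub_of_add_eq' h2]
  module

/-- The one-parameter groups generated by transvections move the base point along great circles. -/
theorem exp_transvection {o v : Cayley} (ho : ⟪o, o⟫_ℝ = 1) (hv : ⟪o, v⟫_ℝ = 0)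
    (hv' : ⟪v, v⟫_ℝ = 1) (t : ℝ) :
    NormedSpace.exp (t • (transvection o v).1) o = Real.cos t • o + Real.sin t • v := by
  set D := (transvection o v).1 with hD
  have h1 : D o = v := by rw [hD, transvection_base ho, hv, zero_smul, sub_zero]
  have h2 : D v = -o := by
    rw [hD, transvection_apply_tangent hv hv, Cayley.cross_self, Cayley.cross_zero_right, hv']
    module
  have hder (t : ℝ) : HasDerivAt (fun u : ℝ => NormedSpace.exp (-u • D)
      (Real.cos u • o + Real.sin u • v)) 0 t := by
    have h : HasDerivAt (fun u : ℝ => NormedSpace.exp (-u • D))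
        (-(NormedSpace.exp (-t • D) * D)) t := by
      simpa [Function.comp_def] using (hasDerivAt_exp_smul_const D (-t)).scomp t (hasDerivAt_neg t)
    have h3 := h.clm_apply (((Real.hasDerivAt_cos t).smul_const o).add
      ((Real.hasDerivAt_sin t).smul_const v))
    convert! h3 using 1
    simp only [neg_apply, mul_apply_eq_comp, Pi.add_apply, map_add, map_smul, h1, h2, map_neg]
    module
  have := is_const_of_deriv_eq_zero (fun s => (hder s).differentiableAt)
    (fun s => (hder s).deriv) t 0
  simp only [neg_zero, zero_smul, NormedSpace.exp_zero, one_apply_eq_self, Real.cos_zero,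
    one_smul, Real.sin_zero, add_zero] at this
  nth_rw 1 [← this]
  rw [← mul_apply_eq_comp, exp_smul_mul_exp_neg_smul D t, one_apply_eq_self]

end g2

/-! ### Transitivity and compactness of `G₂` -/

/-- The cross product as a continuous bilinear map. -/
def Cayley.crossCLM : Cayley →L[ℝ] Cayley →L[ℝ] Cayley := crossL.toContinuousBilinearMap

theorem Cayley.crossCLM_apply (A B : Cayley) : crossCLM A B = cross A B := rfl

namespace G2

theorem inner_toLin (g : G2) (A B : Cayley) : ⟪toLin g A, toLin g B⟫_ℝ = ⟪A, B⟫_ℝ :=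
  (⟨(toLin g).toLinearMap, norm_toLin g⟩ : Cayley →ₗᵢ[ℝ] Cayley).inner_map_map A B

theorem toLin_apply_inv (g : G2) (A : Cayley) : toLin g (toLin g⁻¹ A) = A := by
  rw [← mul_apply_eq_comp, toLin_mul_inv, one_apply_eq_self]

end G2

theorem S6.inner_self (x : S6) : ⟪(x : Cayley), (x : Cayley)⟫_ℝ = 1 := by
  rw [real_inner_self_eq_norm_sq, norm_eq_of_mem_sphere x, one_pow]

/-- Any point `y` of the sphere lies on a great circle through `x`. -/
theorem S6.exists_orthonormal (x y : S6) : ∃ (v : Cayley) (t : ℝ), ⟪(x : Cayley), v⟫_ℝ = 0 ∧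
    ⟪v, v⟫_ℝ = 1 ∧ (y : Cayley) = Real.cos t • (x : Cayley) + Real.sin t • v := by
  have hx := S6.inner_self x
  have hy := S6.inner_self y
  set c : ℝ := ⟪(x : Cayley), (y : Cayley)⟫_ℝ with hc
  have key : ‖(y : Cayley) - c • (x : Cayley)‖ ^ 2 = 1 - c ^ 2 := by
    rw [← real_inner_self_eq_norm_sq, inner_sub_left, inner_sub_right, inner_sub_right,
      real_inner_smul_left, real_inner_smul_left, real_inner_smul_right, real_inner_smul_right,
      hx, hy, real_inner_comm (x : Cayley) y, ← hc]
    ring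
  have hxw : ⟪(x : Cayley), (y : Cayley) - c • (x : Cayley)⟫_ℝ = 0 := by
    rw [inner_sub_right, real_inner_smul_right, hx, ← hc]; ring
  have hc1 : |c| ≤ 1 := by
    have := abs_real_inner_le_norm (x : Cayley) y
    rwa [norm_eq_of_mem_sphere x, norm_eq_of_mem_sphere y, one_mul] at this
  obtain ⟨v, hv, hv', h⟩ : ∃ v : Cayley, ⟪(x : Cayley), v⟫_ℝ = 0 ∧ ⟪v, v⟫_ℝ = 1 ∧
      (y : Cayley) - c • (x : Cayley) = ‖(y : Cayley) - c • (x : Cayley)‖ • v := by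
    -- for `y = ± x` any unit vector orthogonal to `x` will do
    by_cases h0 : (y : Cayley) - c • (x : Cayley) = 0
    · have hrank : 0 < Module.finrank ℝ (ℝ ∙ (x : Cayley))ᗮ := by
        have := Submodule.finrank_orthogonal_span_singleton (𝕜 := ℝ) (n := 6)
          (ne_zero_of_mem_unit_sphere x)
        omega
      obtain ⟨u, hu⟩ := Module.finrank_pos_iff_exists_ne_zero.1 hrank
      have hu' : (u : Cayley) ≠ 0 := by simpa using hu
      have hn : ‖(u : Cayley)‖ ≠ 0 := by simpa using hu'
      refine ⟨‖(u : Cayley)‖⁻¹ • (u : Cayley), ?_, ?_, by rw [h0]; simp⟩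
      · rw [real_inner_smul_right, (Submodule.mem_orthogonal_singleton_iff_inner_right).1 u.2,
          mul_zero]
      · rw [real_inner_smul_left, real_inner_smul_right, real_inner_self_eq_norm_sq]
        field_simp
    · have hn : ‖(y : Cayley) - c • (x : Cayley)‖ ≠ 0 := by rwa [norm_ne_zero_iff]
      refine ⟨‖(y : Cayley) - c • (x : Cayley)‖⁻¹ • ((y : Cayley) - c • (x : Cayley)), ?_, ?_, ?_⟩
      · rw [real_inner_smul_right, hxw, mul_zero]
      · rw [real_inner_smul_left, real_inner_smul_right, real_inner_self_eq_norm_sq]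
        field_simp
      · rw [smul_smul, mul_inv_cancel₀ hn, one_smul]
  refine ⟨v, Real.arccos c, hv, hv', ?_⟩
  rw [Real.cos_arccos (by linarith [abs_le.1 hc1]) (by linarith [abs_le.1 hc1]), Real.sin_arccos,
    ← key, Real.sqrt_sq (norm_nonneg _), ← h, add_sub_cancel]

/-- `G₂` is transitive on the sphere: any two points are joined by the orbit of a one-parameter
group generated by a transvection. -/
instance : MulAction.IsPretransitive G2 S6 where
  exists_smul_eq x y := by
    obtain ⟨v, t, hv, hv', hy⟩ := S6.exists_orthonormal x y
    obtain ⟨g, hg⟩ := (mem_g2_iff_exp _).1 (g2.transvection x v).2 t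
    refine ⟨g, Subtype.ext ?_⟩
    rw [G2.coe_smul, hg, g2.exp_transvection (S6.inner_self x) hv hv', hy]

theorem G2.continuous_toLin : Continuous G2.toLin :=
  Units.continuous_val.comp continuous_subtype_val

theorem G2.norm_toLin_le (g : G2) : ‖toLin g‖ ≤ 1 :=
  ContinuousLinearMap.opNorm_le_bound _ zero_le_one fun A => by rw [norm_toLin, one_mul]

theorem G2.isClosed : IsClosed (G2 : Set (Cayley →L[ℝ] Cayley)ˣ) := by
  have h : (G2 : Set (Cayley →L[ℝ] Cayley)ˣ) =
      ⋂ (A : Cayley) (B : Cayley), {g | g.1 (cross A B) = Cayley.crossCLM (g.1 A) (g.1 B)} := by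
    ext g; simp [G2, Cayley.crossCLM_apply]
  have hc (A : Cayley) : Continuous fun g : (Cayley →L[ℝ] Cayley)ˣ => g.1 A :=
    (ContinuousLinearMap.apply ℝ Cayley A).continuous.comp Units.continuous_val
  rw [h]
  refine isClosed_iInter fun A => isClosed_iInter fun B => isClosed_eq (hc _) ?_
  exact (Cayley.crossCLM.continuous.comp (hc A)).clm_apply (hc B)

/-- `G₂` is compact: it is a closed subgroup of the orthogonal group. -/
instance : CompactSpace G2 := by
  have hf : Topology.IsClosedEmbedding
      (fun g : G2 => Units.embedProduct _ (g : (Cayley →L[ℝ] Cayley)ˣ)) :=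
    Units.isClosedEmbedding_embedProduct.comp G2.isClosed.isClosedEmbedding_subtypeVal
  have hK : IsCompact (Metric.closedBall (0 : Cayley →L[ℝ] Cayley) 1) :=
    have : ProperSpace (Cayley →L[ℝ] Cayley) := FiniteDimensional.proper ℝ _
    isCompact_closedBall _ _
  have hK' := hK.prod (hK.image MulOpposite.continuous_op)
  refine isCompact_univ_iff.1 (hf.isInducing.isCompact_iff.2 (hK'.of_isClosed_subset ?_ ?_))
  · rw [Set.image_univ]; exact hf.isClosed_range
  · rintro _ ⟨g, -, rfl⟩
    exact ⟨mem_closedBall_zero_iff.2 (G2.norm_toLin_le g), _,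
      mem_closedBall_zero_iff.2 (G2.norm_toLin_le g⁻¹), rfl⟩

instance : ContinuousSMul G2 S6 where
  continuous_smul := Continuous.subtype_mk
    ((G2.continuous_toLin.comp continuous_fst).clm_apply
      (continuous_subtype_val.comp continuous_snd)) _

/-- The continuous bijection `G₂ / H → S⁶` is a homeomorphism, since `G₂` is compact. -/
theorem G2.isHomeomorph_orbit (o : S6) : IsHomeomorph (MulAction.ofQuotientStabilizer G2 o) := by
  refine isHomeomorph_iff_continuous_bijective.2 ⟨continuous_quot_lift _
    (continuous_id.smul continuous_const), MulAction.injective_ofQuotientStabilizer G2 o, ?_⟩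
  intro x
  obtain ⟨g, hg⟩ := MulAction.exists_smul_eq G2 o x
  exact ⟨QuotientGroup.mk g, hg⟩

/-! ### The isotropy group is `SU(3)` -/

section

open scoped Matrix

namespace Cayley

/-- The decomposition `𝒴 = ℝ i ⊕ ℂ³`. The coordinates of `ℂ³ = i^⊥` are chosen such that `A ↦ i ×
A` is the multiplication by `√-1`, see `toC3_cross`. -/
def toC3 : Cayley ≃ₗ[ℝ] ℝ × (Fin 3 → ℂ) where
  toFun A := ((WithLp.fst (A : Octonion)).imI,
    ![⟨(WithLp.fst (A : Octonion)).imJ, (WithLp.fst (A : Octonion)).imK⟩,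
      ⟨(WithLp.snd (A : Octonion)).re, (WithLp.snd (A : Octonion)).imI⟩,
      ⟨(WithLp.snd (A : Octonion)).imJ, -(WithLp.snd (A : Octonion)).imK⟩])
  invFun p := ⟨WithLp.toLp 2 (⟨0, p.1, (p.2 0).re, (p.2 0).im⟩,
    ⟨(p.2 1).re, (p.2 1).im, (p.2 2).re, -(p.2 2).im⟩), rfl⟩
  map_add' A B := by
    refine Prod.ext (by simp) (funext fun i => ?_)
    fin_cases i <;> apply Complex.ext <;> simp
    ring
  map_smul' r A := by
    refine Prod.ext (by simp) (funext fun i => ?_)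
    fin_cases i <;> apply Complex.ext <;> simp
  left_inv A := by apply ext_coords <;> simp
  right_inv p := by
    refine Prod.ext (by simp) (funext fun i => ?_)
    fin_cases i <;> apply Complex.ext <;> simp

/-- The cross product of `𝒴` in terms of the hermitian form and the complex cross product of `ℂ³`,
which are both invariant under `SU(3)`. -/
theorem toC3_cross (A B : Cayley) : toC3 (cross A B) =
    ((star (toC3 A).2 ⬝ᵥ (toC3 B).2).im,
      Complex.I • (((toC3 A).1 : ℂ) • (toC3 B).2 - ((toC3 B).1 : ℂ) • (toC3 A).2)
        + star ((toC3 A).2 ⨯₃ (toC3 B).2)) := by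
  refine Prod.ext ?_ (funext fun i => ?_)
  · simp [toC3, cross_fst_imI, dotProduct, Fin.sum_univ_three]
    ring
  · fin_cases i <;> apply Complex.ext <;>
    simp [toC3, cross_fst_imJ, cross_fst_imK, cross_snd_re, cross_snd_imI, cross_snd_imJ,
      cross_snd_imK, cross_apply] <;> ring

theorem inner_eq_toC3 (A B : Cayley) : ⟪A, B⟫_ℝ =
    (toC3 A).1 * (toC3 B).1 + (star (toC3 A).2 ⬝ᵥ (toC3 B).2).re := by
  rw [inner_eq]
  simp [toC3, dotProduct, Fin.sum_univ_three]
  ring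

end Cayley

theorem Matrix.transpose_mulVec_cross {R : Type*} [CommRing R] (U : Matrix (Fin 3) (Fin 3) R)
    (z w : Fin 3 → R) : Uᵀ *ᵥ ((U *ᵥ z) ⨯₃ (U *ᵥ w)) = U.det • (z ⨯₃ w) := by
  ext i
  fin_cases i <;>
    simp [Matrix.mulVec, dotProduct, Fin.sum_univ_three, cross_apply, Matrix.det_fin_three] <;> ring

theorem Matrix.conjTranspose_mulVec_star_cross (U : Matrix (Fin 3) (Fin 3) ℂ) (z w : Fin 3 → ℂ) :
    Uᴴ *ᵥ star ((U *ᵥ z) ⨯₃ (U *ᵥ w)) = star U.det • star (z ⨯₃ w) := by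
  have h := congrArg star (Matrix.transpose_mulVec_cross U z w)
  rw [star_smul, Matrix.star_mulVec, ← Matrix.mulVec_transpose] at h
  exact h

theorem Matrix.mulVec_star_cross {U : Matrix (Fin 3) (Fin 3) ℂ}
    (hU : U ∈ Matrix.specialUnitaryGroup (Fin 3) ℂ) (z w : Fin 3 → ℂ) :
    U *ᵥ star (z ⨯₃ w) = star ((U *ᵥ z) ⨯₃ (U *ᵥ w)) := by
  have h := Matrix.conjTranspose_mulVec_star_cross U z w
  rw [(Matrix.mem_specialUnitaryGroup_iff.1 hU).2, star_one, one_smul] at h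
  rw [← h, Matrix.mulVec_mulVec, ← Matrix.star_eq_conjTranspose, hU.1.2, Matrix.one_mulVec]

theorem Matrix.star_mulVec_dotProduct_mulVec {U : Matrix (Fin 3) (Fin 3) ℂ}
    (hU : U ∈ Matrix.specialUnitaryGroup (Fin 3) ℂ) (z w : Fin 3 → ℂ) :
    star (U *ᵥ z) ⬝ᵥ (U *ᵥ w) = star z ⬝ᵥ w := by
  rw [Matrix.star_mulVec, ← Matrix.dotProduct_mulVec, Matrix.mulVec_mulVec,
    ← Matrix.star_eq_conjTranspose, hU.1.1, Matrix.one_mulVec]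

namespace SU3

open Cayley (toC3)

/-- The point `i` of `S⁶`. -/
def base : S6 := ⟨toC3.symm (1, 0), by
  rw [mem_sphere_zero_iff_norm, ← sq_eq_sq₀ (norm_nonneg _) zero_le_one,
    ← real_inner_self_eq_norm_sq, Cayley.inner_eq_toC3]
  simp⟩

theorem toC3_base : toC3 (base : Cayley) = (1, 0) := toC3.apply_symm_apply _

/-- The linear action of complex matrices on `𝒴 = ℝ i ⊕ ℂ³`. -/
def act : Matrix (Fin 3) (Fin 3) ℂ →* (Cayley →L[ℝ] Cayley) where
  toFun U := LinearMap.toContinuousLinearMap (toC3.symm.toLinearMap ∘ₗ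
    (LinearMap.id.prodMap ((Matrix.mulVecLin U).restrictScalars ℝ)) ∘ₗ toC3.toLinearMap)
  map_one' := by
    ext1 A
    simp
  map_mul' U V := by
    ext1 A
    simp

theorem toC3_act (U : Matrix (Fin 3) (Fin 3) ℂ) (A : Cayley) :
    toC3 (act U A) = ((toC3 A).1, U *ᵥ (toC3 A).2) := by
  simp [act]

theorem act_cross {U : Matrix (Fin 3) (Fin 3) ℂ} (hU : U ∈ Matrix.specialUnitaryGroup (Fin 3) ℂ)
    (A B : Cayley) : act U (cross A B) = cross (act U A) (act U B) := by
  apply toC3.injective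
  rw [toC3_act, Cayley.toC3_cross, Cayley.toC3_cross, toC3_act, toC3_act,
    Matrix.star_mulVec_dotProduct_mulVec hU]
  simp only [Matrix.mulVec_add, Matrix.mulVec_smul, Matrix.mulVec_sub, Matrix.mulVec_star_cross hU]

/-- The action of `SU(3)` on `𝒴 = ℝ i ⊕ ℂ³` as a homomorphism to `G₂`. -/
def toG2 : Matrix.specialUnitaryGroup (Fin 3) ℂ →* G2 :=
  ((act.comp (Matrix.specialUnitaryGroup (Fin 3) ℂ).subtype).toHomUnits).codRestrict G2
    fun U A B => act_cross U.2 A B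

theorem toLin_toG2 (U : Matrix.specialUnitaryGroup (Fin 3) ℂ) :
    G2.toLin (toG2 U) = act U.1 := rfl

theorem toG2_smul_base (U : Matrix.specialUnitaryGroup (Fin 3) ℂ) : toG2 U • base = base := by
  apply Subtype.ext
  apply toC3.injective
  rw [G2.coe_smul, toLin_toG2, toC3_act, toC3_base, Matrix.mulVec_zero]

/-- The action of `SU(3)` on `𝒴` as a homomorphism to the isotropy group of `i`. -/
def toStabilizer : Matrix.specialUnitaryGroup (Fin 3) ℂ →* MulAction.stabilizer G2 base :=
  toG2.codRestrict _ toG2_smul_base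

/-- The matrix of the action on `ℂ³`. It is defined for all elements of `G₂`, but it describes the
action only for those that fix `i`. -/
def matrixOf (g : G2) : Matrix (Fin 3) (Fin 3) ℂ :=
  .of fun i j => (toC3 (G2.toLin g (toC3.symm (0, Pi.single j 1)))).2 i

theorem matrixOf_toG2 (U : Matrix.specialUnitaryGroup (Fin 3) ℂ) : matrixOf (toG2 U) = U.1 := by
  ext i j
  simp [matrixOf, toLin_toG2, toC3_act]

theorem continuous_matrixOf : Continuous matrixOf := by
  refine continuous_matrix fun i j => ?_
  have h : Continuous fun A : Cayley => (toC3 A).2 i :=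
    LinearMap.continuous_of_finiteDimensional
      (LinearMap.proj i ∘ₗ LinearMap.snd ℝ ℝ (Fin 3 → ℂ) ∘ₗ toC3.toLinearMap)
  exact h.comp (G2.continuous_toLin.clm_apply continuous_const)

theorem toLin_base {g : G2} (hg : g • base = base) : G2.toLin g base = base :=
  congrArg Subtype.val hg

theorem toC3_toLin_fst {g : G2} (hg : g • base = base) (A : Cayley) :
    (toC3 (G2.toLin g A)).1 = (toC3 A).1 := by
  have h := G2.inner_toLin g base A
  rw [toLin_base hg, Cayley.inner_eq_toC3, Cayley.inner_eq_toC3, toC3_base] at h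
  simpa using h

/-- The unit `i` acts on `ℂ³` as the cross product with the base point, so that the elements of the
isotropy group are complex linear. -/
theorem toC3_toLin_I_smul {g : G2} (hg : g • base = base) (z : Fin 3 → ℂ) :
    (toC3 (G2.toLin g (toC3.symm (0, Complex.I • z)))).2
      = Complex.I • (toC3 (G2.toLin g (toC3.symm (0, z)))).2 := by
  have hJ (A : Cayley) : (toC3 (cross base A)).2 = Complex.I • (toC3 A).2 := by
    rw [Cayley.toC3_cross, toC3_base]
    simp
  have h : toC3.symm (0, Complex.I • z) = cross base (toC3.symm (0, z)) := by
    apply toC3.injective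
    rw [Cayley.toC3_cross, toC3_base]
    simp
  rw [h, G2.toLin_cross, toLin_base hg, hJ]

/-- The action of an element of the isotropy group of `i` on `i^⊥ = ℂ³`, as a complex linear map. -/
def complexLin {g : G2} (hg : g • base = base) : (Fin 3 → ℂ) →ₗ[ℂ] (Fin 3 → ℂ) :=
  let f : (Fin 3 → ℂ) →ₗ[ℝ] (Fin 3 → ℂ) := LinearMap.snd ℝ ℝ (Fin 3 → ℂ) ∘ₗ toC3.toLinearMap ∘ₗ
    (G2.toLin g).toLinearMap ∘ₗ toC3.symm.toLinearMap ∘ₗ LinearMap.inr ℝ ℝ (Fin 3 → ℂ)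
  { toFun := f
    map_add' := f.map_add
    map_smul' := fun c z => by
      have h : c • z = c.re • z + c.im • Complex.I • z := by
        rw [← Complex.coe_smul, ← Complex.coe_smul, smul_smul, ← add_smul, Complex.re_add_im]
      have hI : f (Complex.I • z) = Complex.I • f z := toC3_toLin_I_smul hg z
      rw [h, map_add, map_smul, map_smul, hI, RingHom.id_apply]
      rw [← Complex.coe_smul, ← Complex.coe_smul, smul_smul, ← add_smul, Complex.re_add_im] }

theorem complexLin_apply {g : G2} (hg : g • base = base) (z : Fin 3 → ℂ) :
    complexLin hg z = (toC3 (G2.toLin g (toC3.symm (0, z)))).2 := rfl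

theorem matrixOf_mulVec {g : G2} (hg : g • base = base) (z : Fin 3 → ℂ) :
    matrixOf g *ᵥ z = (toC3 (G2.toLin g (toC3.symm (0, z)))).2 := by
  rw [← complexLin_apply hg, ← LinearMap.toMatrix'_mulVec (complexLin hg)]
  congr 1

theorem act_matrixOf {g : G2} (hg : g • base = base) : act (matrixOf g) = G2.toLin g := by
  ext1 A
  apply toC3.injective
  rw [toC3_act]
  refine Prod.ext (toC3_toLin_fst hg A).symm ?_
  have h : A = (toC3 A).1 • (base : Cayley) + toC3.symm (0, (toC3 A).2) := by
    apply toC3.injective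
    rw [map_add, map_smul, toC3_base]
    simp
  conv_rhs => rw [h]
  rw [matrixOf_mulVec hg, map_add, map_smul, toLin_base hg, map_add, map_smul, toC3_base]
  simp

theorem star_matrixOf_mulVec_dotProduct {g : G2} (hg : g • base = base) (z w : Fin 3 → ℂ) :
    star (matrixOf g *ᵥ z) ⬝ᵥ (matrixOf g *ᵥ w) = star z ⬝ᵥ w := by
  have h0 (z : Fin 3 → ℂ) : toC3 (G2.toLin g (toC3.symm (0, z))) = (0, matrixOf g *ᵥ z) := by
    rw [← act_matrixOf hg, toC3_act, LinearEquiv.apply_symm_apply]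
  have h1 := G2.inner_toLin g (toC3.symm (0, z)) (toC3.symm (0, w))
  have h2 := toC3_toLin_fst hg (cross (toC3.symm (0, z)) (toC3.symm (0, w)))
  rw [Cayley.inner_eq_toC3, Cayley.inner_eq_toC3] at h1
  rw [G2.toLin_cross, Cayley.toC3_cross, Cayley.toC3_cross] at h2
  simp only [h0, LinearEquiv.apply_symm_apply, zero_mul, zero_add] at h1 h2
  exact Complex.ext h1 h2

theorem matrixOf_mem {g : G2} (hg : g • base = base) :
    matrixOf g ∈ Matrix.specialUnitaryGroup (Fin 3) ℂ := by
  have hU : star (matrixOf g) * matrixOf g = 1 := by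
    ext i j
    have h := star_matrixOf_mulVec_dotProduct hg (Pi.single i 1) (Pi.single j 1)
    rw [Matrix.star_mulVec, ← Matrix.dotProduct_mulVec, Matrix.mulVec_mulVec] at h
    rw [Matrix.star_eq_conjTranspose]
    simpa [Matrix.one_apply, Pi.single_apply, eq_comm] using h
  refine Matrix.mem_specialUnitaryGroup_iff.2 ⟨Matrix.mem_unitaryGroup_iff'.2 hU, ?_⟩
  -- the determinant is read off from the action on the complex cross product `e₁ × e₂ = e₃`
  have h0 (z : Fin 3 → ℂ) : toC3 (G2.toLin g (toC3.symm (0, z))) = (0, matrixOf g *ᵥ z) := by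
    rw [← act_matrixOf hg, toC3_act, LinearEquiv.apply_symm_apply]
  have hc (z w : Fin 3 → ℂ) : matrixOf g *ᵥ star (z ⨯₃ w)
      = star ((matrixOf g *ᵥ z) ⨯₃ (matrixOf g *ᵥ w)) := by
    have h := congrArg (fun A => (toC3 A).2)
      (G2.toLin_cross g (toC3.symm (0, z)) (toC3.symm (0, w)))
    simp only [Cayley.toC3_cross, ← act_matrixOf hg, toC3_act,
      LinearEquiv.apply_symm_apply] at h
    simpa using h
  have h := Matrix.conjTranspose_mulVec_star_cross (matrixOf g) (Pi.single 0 1) (Pi.single 1 1)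
  rw [← hc, Matrix.mulVec_mulVec, ← Matrix.star_eq_conjTranspose, hU, Matrix.one_mulVec] at h
  have h2 := congrFun h 2
  have h3 := congrArg star h2
  simpa [cross_apply] using h3.symm

instance (o : S6) : CompactSpace (MulAction.stabilizer G2 o) := by
  have h : IsClosed {g : G2 | g • o = o} :=
    isClosed_eq (continuous_id.smul continuous_const) continuous_const
  exact isCompact_iff_compactSpace.1 h.isCompact

/-- The isotropy group of `i` is `SU(3)`. -/
def stabilizerEquiv : MulAction.stabilizer G2 base ≃ₜ* Matrix.specialUnitaryGroup (Fin 3) ℂ :=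
  let e : MulAction.stabilizer G2 base ≃ Matrix.specialUnitaryGroup (Fin 3) ℂ :=
    { toFun g := ⟨matrixOf g.1, matrixOf_mem g.2⟩
      invFun := toStabilizer
      left_inv g := by
        apply Subtype.ext
        apply Subtype.ext
        apply Units.ext
        exact act_matrixOf g.2
      right_inv U := Subtype.ext (matrixOf_toG2 U) }
  have he : Continuous e := (continuous_matrixOf.comp continuous_subtype_val).subtype_mk _
  { e with
    map_mul' g h := by
      apply e.symm.injective
      exact ((e.symm_apply_apply _).trans (congrArg₂ (· * ·) (e.symm_apply_apply g).symm
        (e.symm_apply_apply h).symm)).trans (toStabilizer.map_mul _ _).symm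
    continuous_toFun := he
    continuous_invFun := (he.homeoOfEquivCompactToT2).symm.continuous }

/-- All isotropy groups are `SU(3)`, since they are conjugate. -/
theorem nonempty_stabilizer_equiv (o : S6) :
    Nonempty (MulAction.stabilizer G2 o ≃ₜ* Matrix.specialUnitaryGroup (Fin 3) ℂ) := by
  obtain ⟨g, hg⟩ := MulAction.exists_smul_eq G2 o base
  have hc (k : G2) : Continuous fun h : G2 => MulAut.conj k h := by
    simp only [MulAut.conj_apply]; fun_prop
  let e := MulAction.stabilizerEquivStabilizer hg.symm
  refine ⟨ContinuousMulEquiv.trans { e with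
    continuous_toFun := ?_
    continuous_invFun := ?_ } stabilizerEquiv⟩
  · exact ((hc g).comp continuous_subtype_val).subtype_mk _
  · exact ((hc g⁻¹).comp continuous_subtype_val).subtype_mk _

/-- The element of the isotropy group of `o` that rotates `T_o S⁶` by the angle `2π / 3` with
respect to the complex structure `A ↦ o × A`. For `o = i` it is the matrix `ζ • 1`, where `ζ` is a
primitive third root of unity; this is the reason why it has determinant one. -/
theorem exists_rotation (o : S6) : ∃ k : G2, ∀ A : Cayley, G2.toLin k A =
    ⟪(o : Cayley), A⟫_ℝ • (o : Cayley)
      + (-1 / 2 : ℝ) • (A - ⟪(o : Cayley), A⟫_ℝ • (o : Cayley)) + (√3 / 2) • cross o A := by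
  set ζ : ℂ := ⟨-1 / 2, √3 / 2⟩ with hζ
  have h3 : √3 * √3 = 3 := Real.mul_self_sqrt (by norm_num)
  have hζ1 : star ζ * ζ = 1 := by
    apply Complex.ext <;> simp [hζ] <;> linarith
  have hζ3 : ζ ^ 3 = 1 := by
    apply Complex.ext <;> simp [hζ, pow_succ]
    · linear_combination (3 / 8) * h3
    · linear_combination (-√3 / 8) * h3
  have hU : (ζ • (1 : Matrix (Fin 3) (Fin 3) ℂ)) ∈ Matrix.specialUnitaryGroup (Fin 3) ℂ := by
    refine Matrix.mem_specialUnitaryGroup_iff.2 ⟨Matrix.mem_unitaryGroup_iff'.2 ?_, ?_⟩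
    · rw [star_smul, star_one, smul_mul_smul_comm, hζ1, one_smul, one_mul]
    · rw [Matrix.det_smul, Matrix.det_one, Fintype.card_fin, hζ3, mul_one]
  have hbase (A : Cayley) : act (ζ • 1) A = ⟪(base : Cayley), A⟫_ℝ • (base : Cayley)
      + (-1 / 2 : ℝ) • (A - ⟪(base : Cayley), A⟫_ℝ • (base : Cayley))
      + (√3 / 2) • cross base A := by
    apply toC3.injective
    simp only [map_add, map_smul, map_sub, toC3_act, Cayley.toC3_cross, Cayley.inner_eq_toC3,
      toC3_base]
    refine Prod.ext (by simp) (funext fun i => ?_)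
    apply Complex.ext <;> simp [hζ, Matrix.smul_mulVec]
    ring
  obtain ⟨g, hg⟩ := MulAction.exists_smul_eq G2 base o
  have hgo : (o : Cayley) = G2.toLin g base := by rw [← hg, G2.coe_smul]
  refine ⟨g * toG2 ⟨_, hU⟩ * g⁻¹, fun A => ?_⟩
  obtain ⟨B, rfl⟩ : ∃ B, A = G2.toLin g B := ⟨_, (G2.toLin_apply_inv g A).symm⟩
  rw [G2.toLin_mul, G2.toLin_mul, mul_apply_eq_comp, mul_apply_eq_comp, G2.toLin_inv_apply,
    toLin_toG2, hbase, hgo, G2.inner_toLin, ← G2.toLin_cross]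
  simp only [map_add, map_smul, map_sub]

end SU3

end

/-! ### Reductive complements -/

/-- On `o^⊥` the trilinear form `⟨o × (u × v), w⟩` is skew in the last two arguments, hence totally
skew. -/
theorem Cayley.inner_cross_cross_skew {o u v w : Cayley} (hu : ⟪o, u⟫_ℝ = 0) (hv : ⟪o, v⟫_ℝ = 0)
    (hw : ⟪o, w⟫_ℝ = 0) : ⟪cross o (cross u v), w⟫_ℝ = -⟪cross o (cross u w), v⟫_ℝ := by
  have h := congrArg (fun A => ⟪A, w⟫_ℝ) (Cayley.cross_cross_polar o u v)
  simp only [inner_add_left, inner_sub_left, real_inner_smul_left, hu, hv, hw] at h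
  rw [inner_cross_left u, inner_cross_left o v] at h
  rw [real_inner_comm v]
  linarith

theorem g2.inner_base_apply (o : S6) (D : g2) : ⟪(o : Cayley), D.1 o⟫_ℝ = 0 := by
  rw [real_inner_comm, g2.inner_apply_self]

theorem g2.transvection_apply_base (o : S6) {v : Cayley} (hv : ⟪(o : Cayley), v⟫_ℝ = 0) :
    (g2.transvection o v).1 o = v := by
  rw [g2.transvection_base (S6.inner_self o), hv, zero_smul, sub_zero]

/-- The differential of the orbit map is onto the tangent space. -/
theorem g2.exists_apply_eq (o : S6) {w : Cayley} (hw : ⟪(o : Cayley), w⟫_ℝ = 0) :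
    ∃ D : g2, D.1 o = w := ⟨_, g2.transvection_apply_base o hw⟩

theorem G2.Ad_apply (g : G2) (D : g2) (A : Cayley) :
    (G2.Ad g D).1 (G2.toLin g A) = G2.toLin g (D.1 A) := by
  change G2.toLin g (D.1 (G2.toLin g⁻¹ (G2.toLin g A))) = _
  rw [G2.toLin_inv_apply]

theorem g2.ext_toLin (g : G2) {D E : g2}
    (h : ∀ A, D.1 (G2.toLin g A) = E.1 (G2.toLin g A)) : D = E := by
  apply Subtype.ext
  ext1 A
  rw [← G2.toLin_apply_inv g A, h]

theorem G2.Ad_transvection (g : G2) (o v : Cayley) :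
    G2.Ad g (g2.transvection o v) = g2.transvection (G2.toLin g o) (G2.toLin g v) := by
  apply g2.ext_toLin g
  intro A
  rw [G2.Ad_apply, g2.transvection_apply, g2.transvection_apply]
  simp only [← G2.toLin_cross, G2.inner_toLin, map_smul, map_add, map_sub]

theorem G2.toLin_of_mem_stabilizer {k : G2} {o : S6} (hk : k ∈ MulAction.stabilizer G2 o) :
    G2.toLin k o = o := congrArg Subtype.val hk

/-- The complement of the isotropy algebra of `o` that consists of the transvections. -/
def transvections (o : S6) : Submodule ℝ g2 := LinearMap.range (g2.transvection o)

theorem g2.eq_transvection_of_mem {o : S6} {X : g2} (hX : X ∈ transvections o) :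
    X = g2.transvection o (X.1 o) := by
  obtain ⟨v, rfl⟩ := hX
  apply Subtype.ext
  ext1 x
  rw [g2.transvection_base (S6.inner_self o), g2.transvection_apply, g2.transvection_apply]
  simp only [Cayley.cross_sub_left, Cayley.cross_smul_left, Cayley.cross_self,
    Cayley.cross_zero_left,
    Cayley.cross_cross, inner_sub_left, real_inner_smul_left, S6.inner_self]
  module

theorem isReductiveComplement_transvections (o : S6) :
    IsReductiveComplement o (transvections o) where
  isCompl := by
    refine ⟨Submodule.disjoint_def.2 fun D hD hD' => ?_, codisjoint_iff.2 (eq_top_iff.2 ?_)⟩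
    · rw [g2.eq_transvection_of_mem hD', show D.1 o = 0 from hD, map_zero]
    · intro D _
      refine Submodule.mem_sup.2 ⟨D - g2.transvection o (D.1 o), ?_, _, ⟨D.1 o, rfl⟩,
        sub_add_cancel _ _⟩
      change D.1 o - (g2.transvection o (D.1 o)).1 o = 0
      rw [g2.transvection_apply_base o (g2.inner_base_apply o D), sub_self]
  ad_mem k hk D hD := by
    obtain ⟨v, rfl⟩ := hD
    exact ⟨G2.toLin k v, by rw [G2.Ad_transvection, G2.toLin_of_mem_stabilizer hk]⟩

/-- The rotation of order three satisfies `1 + k + k² = 0` on `o^⊥`. -/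
theorem sum_rotation_eq_zero {o : S6} {k : G2} (hk : ∀ A : Cayley, G2.toLin k A =
    ⟪(o : Cayley), A⟫_ℝ • (o : Cayley)
      + (-1 / 2 : ℝ) • (A - ⟪(o : Cayley), A⟫_ℝ • (o : Cayley)) + (√3 / 2) • cross o A)
    {v : Cayley} (hv : ⟪(o : Cayley), v⟫_ℝ = 0) :
    v + G2.toLin k v + G2.toLin k (G2.toLin k v) = 0 := by
  have h3 : √3 * √3 = 3 := Real.mul_self_sqrt (by norm_num)
  have h1 {w : Cayley} (hw : ⟪(o : Cayley), w⟫_ℝ = 0) :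
      G2.toLin k w = (-1 / 2 : ℝ) • w + (√3 / 2) • cross o w := by
    rw [hk, hw]; module
  have h2 : ⟪(o : Cayley), (-1 / 2 : ℝ) • v + (√3 / 2) • cross o v⟫_ℝ = 0 := by
    rw [inner_add_right, real_inner_smul_right, real_inner_smul_right, hv, Cayley.inner_self_cross]
    ring
  have h4 : (√3 / 2) • (√3 / 2) • v = (3 / 4 : ℝ) • v := by
    rw [smul_smul]; congr 1; linarith
  rw [h1 hv, h1 h2, Cayley.cross_add_right, Cayley.cross_smul_right, Cayley.cross_smul_right,
    Cayley.cross_cross, hv, S6.inner_self, one_smul, zero_smul, zero_sub]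
  simp only [smul_add, smul_neg, h4]
  module

/-- The rotation of order three is central in the isotropy group: it is built from `o`, the scalar
product and the cross product, which are annihilated by the isotropy algebra. -/
theorem Ad_eq_self_of_rotation {o : S6} {k : G2} (hk : ∀ A : Cayley, G2.toLin k A =
    ⟪(o : Cayley), A⟫_ℝ • (o : Cayley)
      + (-1 / 2 : ℝ) • (A - ⟪(o : Cayley), A⟫_ℝ • (o : Cayley)) + (√3 / 2) • cross o A)
    {D : g2} (hD : D.1 o = 0) : G2.Ad k D = D := by
  apply g2.ext_toLin k
  intro A
  have h : ⟪(o : Cayley), D.1 A⟫_ℝ = 0 := by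
    rw [← neg_eq_zero, ← g2.inner_apply_left, hD, inner_zero_left]
  rw [G2.Ad_apply, hk, hk, h]
  simp only [map_add, map_smul, map_sub, hD, g2.apply_cross, Cayley.cross_zero_left]
  module

theorem G2.Ad_sub (k : G2) (D E : g2) : G2.Ad k (D - E) = G2.Ad k D - G2.Ad k E := by
  apply g2.ext_toLin k
  intro A
  change _ = (G2.Ad k D).1 _ - (G2.Ad k E).1 _
  rw [G2.Ad_apply, G2.Ad_apply, G2.Ad_apply, ← map_sub]
  rfl

theorem eq_of_add_add_eq_zero {E : Type*} [AddCommGroup E] [Module ℝ E] {x x₁ x₂ y y₁ y₂ : E}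
    (hx : x + x₁ + x₂ = 0) (hy : y + y₁ + y₂ = 0) (h₁ : x₁ - y₁ = x - y) (h₂ : x₂ - y₂ = x - y) :
    x = y := by
  have h : (3 : ℝ) • (x - y) = 0 := by
    rw [sub_eq_iff_eq_add] at h₁ h₂
    rw [h₁, h₂] at hx
    rw [← sub_eq_zero.2 (hx.trans hy.symm)]
    module
  exact sub_eq_zero.1 ((smul_eq_zero.1 h).resolve_left (by norm_num))

/-- Every reductive complement consists of transvections. The element `k` of order three in the
centre of the isotropy group acts on `T_o S⁶` without fixed vectors, so `1 + Ad k + (Ad k)²`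
vanishes on any reductive complement, but it is `3` on the isotropy algebra. -/
theorem IsReductiveComplement.eq_transvection {o : S6} {m : Submodule ℝ g2}
    (hm : IsReductiveComplement o m) {X : g2} (hX : X ∈ m) :
    X = g2.transvection o (X.1 o) := by
  obtain ⟨k, hk⟩ := SU3.exists_rotation o
  have hko : G2.toLin k o = o := by
    rw [hk, S6.inner_self, Cayley.cross_self]; module
  have hko' : k ∈ MulAction.stabilizer G2 o := Subtype.ext hko
  have hv := g2.inner_base_apply o X
  have hsum := sum_rotation_eq_zero hk hv
  have hAd (D : g2) : (G2.Ad k D).1 o = G2.toLin k (D.1 o) := by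
    conv_lhs => rw [← hko]
    exact G2.Ad_apply k D o
  have hX0 : X + G2.Ad k X + G2.Ad k (G2.Ad k X) = 0 := by
    refine Submodule.disjoint_def.1 hm.isCompl.disjoint _ ?_
      (m.add_mem (m.add_mem hX (hm.ad_mem k hko' X hX))
        (hm.ad_mem k hko' _ (hm.ad_mem k hko' X hX)))
    change X.1 o + (G2.Ad k X).1 o + (G2.Ad k (G2.Ad k X)).1 o = 0
    rw [hAd, hAd, hAd, hsum]
  generalize hY : g2.transvection o (X.1 o) = Y
  have hY0 : Y + G2.Ad k Y + G2.Ad k (G2.Ad k Y) = 0 := by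
    rw [← hY, G2.Ad_transvection, G2.Ad_transvection, hko, hko,
      ← map_add, ← map_add, hsum, map_zero]
  have hE : G2.Ad k (X - Y) = X - Y := by
    apply Ad_eq_self_of_rotation hk
    change X.1 o - Y.1 o = 0
    rw [← hY, g2.transvection_apply_base o hv, sub_self]
  have hE1 : G2.Ad k X - G2.Ad k Y = X - Y := (G2.Ad_sub k X Y).symm.trans hE
  have hE2 : G2.Ad k (G2.Ad k X) - G2.Ad k (G2.Ad k Y) = X - Y :=
    (G2.Ad_sub k _ _).symm.trans ((congrArg (G2.Ad k) hE1).trans hE)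
  apply Subtype.ext
  ext1 A
  have h0 : X.1 A + (G2.Ad k X).1 A + (G2.Ad k (G2.Ad k X)).1 A = 0 :=
    congrArg (fun D : g2 => D.1 A) hX0
  have h0' : Y.1 A + (G2.Ad k Y).1 A + (G2.Ad k (G2.Ad k Y)).1 A = 0 :=
    congrArg (fun D : g2 => D.1 A) hY0
  have h1 : (G2.Ad k X).1 A - (G2.Ad k Y).1 A = X.1 A - Y.1 A :=
    congrArg (fun D : g2 => D.1 A) hE1
  have h2 : (G2.Ad k (G2.Ad k X)).1 A - (G2.Ad k (G2.Ad k Y)).1 A = X.1 A - Y.1 A :=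
    congrArg (fun D : g2 => D.1 A) hE2
  exact eq_of_add_add_eq_zero h0 h0' h1 h2

/-- The `h`-component of the bracket vanishes at `o`, so that the `m`-component has the same value
at `o` as the commutator. -/
theorem bracketM_apply_base {o : S6} {m : Submodule ℝ g2} (hm : IsReductiveComplement o m)
    (X Y : g2) : (bracketM hm X Y).1 o = X.1 (Y.1 o) - Y.1 (X.1 o) := by
  have h := Submodule.projection_add_projection_eq_self hm.isCompl.symm ⁅X, Y⁆
  have h' : (isotropyAlgebra o).projection m hm.isCompl ⁅X, Y⁆ ∈ isotropyAlgebra o :=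
    Submodule.projection_apply_mem _ _
  have h2 : (bracketM hm X Y).1 o + ((isotropyAlgebra o).projection m hm.isCompl ⁅X, Y⁆).1 o
      = (⁅X, Y⁆ : g2).1 o := congrArg (fun D : g2 => D.1 o) h
  rw [show ((isotropyAlgebra o).projection m hm.isCompl ⁅X, Y⁆).1 o = 0 from h', add_zero] at h2
  exact h2

/-- Under the identification `m = T_o S⁶`, the bracket `[X, Y]_m` is `J (X × Y)`. -/
theorem IsReductiveComplement.bracketM_apply_base_of_mem {o : S6} {m : Submodule ℝ g2}
    (hm : IsReductiveComplement o m) {X Y : g2} (hX : X ∈ m) (hY : Y ∈ m) :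
    (bracketM hm X Y).1 o = cross o (cross (X.1 o) (Y.1 o)) := by
  rw [bracketM_apply_base, hm.eq_transvection hX, hm.eq_transvection hY]
  have hx := g2.inner_base_apply o X
  have hy := g2.inner_base_apply o Y
  rw [g2.transvection_apply_base o hx, g2.transvection_apply_base o hy,
    g2.transvection_apply_tangent hx hy, g2.transvection_apply_tangent hy hx,
    real_inner_comm (X.1 o), Cayley.cross_swap (Y.1 o), ← neg_one_smul ℝ (cross (X.1 o) _),
    Cayley.cross_smul_right]
  module

theorem IsReductiveComplement.isNaturallyReductive {o : S6} {m : Submodule ℝ g2}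
    (hm : IsReductiveComplement o m) : IsNaturallyReductive o m where
  reductive := hm
  skew X hX Y hY Z hZ := by
    rw [innerM, innerM, hm.bracketM_apply_base_of_mem hX hY, hm.bracketM_apply_base_of_mem hX hZ]
    exact Cayley.inner_cross_cross_skew (g2.inner_base_apply o X)
      (g2.inner_base_apply o Y) (g2.inner_base_apply o Z)

/-! ### Smoothness of tangential objects in the ambient space -/

namespace S6

open Bundle Filter VectorField
open scoped Topology

local notation "E6" => EuclideanSpace ℝ (Fin 6)

/-- The preferred trivialization of the tangent bundle around a point. -/
abbrev triv (x₀ : S6) := trivializationAt E6 (TangentSpace (𝓡 6) : S6 → Type) x₀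

theorem mem_triv (x₀ : S6) : x₀ ∈ (triv x₀).baseSet := mem_baseSet_trivializationAt _ _ _

theorem eventually_mem_triv (x₀ : S6) : ∀ᶠ x in 𝓝 x₀, x ∈ (triv x₀).baseSet :=
  (triv x₀).open_baseSet.mem_nhds (mem_triv x₀)

/-- The derivative of a vector-valued function is smooth in the coordinates of the tangent
bundle. -/
theorem contMDiffAt_mvfderiv_comp_symmL {m n : ℕ∞ω} {f : S6 → Cayley} {x₀ : S6}
    (hf : ContMDiffAt (𝓡 6) 𝓘(ℝ, Cayley) n f x₀) (hmn : m + 1 ≤ n) :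
    ContMDiffAt (𝓡 6) 𝓘(ℝ, E6 →L[ℝ] Cayley) m
      (fun x => (mvfderiv (𝓡 6) f x).comp ((triv x₀).symmL ℝ x)) x₀ := by
  have h := hf.mfderiv_const hmn
  refine h.congr_of_eventuallyEq (Eventually.of_forall fun x => ?_)
  simp only [inTangentCoordinates, ContinuousLinearMap.inCoordinates,
    TangentBundle.continuousLinearMapAt_model_space]
  rfl

theorem contMDiff_coe {n : ℕ∞ω} : ContMDiff (𝓡 6) 𝓘(ℝ, Cayley) n (Subtype.val : S6 → Cayley) :=
  contMDiff_coe_sphere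

theorem incl_injective (x : S6) : Function.Injective (incl x) :=
  injective_mvfderiv_subtypeVal_sphere x

theorem inner_incl (x : S6) (v : TangentSpace (𝓡 6) x) : ⟪(x : Cayley), incl x v⟫_ℝ = 0 := by
  have h : incl x v ∈ (mvfderiv (𝓡 6) (Subtype.val : S6 → Cayley) x).range := ⟨v, rfl⟩
  rw [range_mvfderiv_subtypeVal] at h
  exact (Submodule.mem_orthogonal_singleton_iff_inner_right).1 h

/-- The coordinates of a tangent vector near `x₀` depend linearly on its image in `𝒴`, by linear
maps that vary smoothly with the point. -/
theorem exists_leftInverse_incl (n : ℕ∞ω) (x₀ : S6) : ∃ B : S6 → Cayley →L[ℝ] E6,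
    ContMDiffAt (𝓡 6) 𝓘(ℝ, Cayley →L[ℝ] E6) n B x₀ ∧
    ∀ᶠ x in 𝓝 x₀, ∀ v : TangentSpace (𝓡 6) x,
      B x (incl x v) = (triv x₀).continuousLinearMapAt ℝ x v := by
  let A (x : S6) : E6 →L[ℝ] Cayley := (incl x).comp ((triv x₀).symmL ℝ x)
  have hA : ContMDiffAt (𝓡 6) 𝓘(ℝ, E6 →L[ℝ] Cayley) n A x₀ :=
    contMDiffAt_mvfderiv_comp_symmL (n := n + 1) contMDiff_coe.contMDiffAt le_rfl
  have hinj : Function.Injective (A x₀) := by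
    refine (incl_injective x₀).comp ?_
    exact Function.LeftInverse.injective
      ((triv x₀).continuousLinearMapAt_symmL (mem_triv x₀))
  obtain ⟨L, hL⟩ := LinearMap.exists_leftInverse_of_injective (A x₀).toLinearMap
    (LinearMap.ker_eq_bot.2 hinj)
  let L' : Cayley →L[ℝ] E6 := LinearMap.toContinuousLinearMap L
  have hL' : L'.comp (A x₀) = (ContinuousLinearEquiv.refl ℝ E6 : E6 →L[ℝ] E6) := by
    ext1 v
    exact congrArg (fun f : E6 →ₗ[ℝ] E6 => f v) hL
  have hLA : ContMDiffAt (𝓡 6) 𝓘(ℝ, E6 →L[ℝ] E6) n (fun x => L'.comp (A x)) x₀ :=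
    contMDiffAt_const.clm_comp hA
  -- `L' ∘ A x` is the identity for `x = x₀`, hence invertible near `x₀`
  refine ⟨fun x => (L'.comp (A x)).inverse.comp L', ?_, ?_⟩
  · refine ContMDiffAt.clm_comp ?_ contMDiffAt_const
    have h := contDiffAt_map_inverse (n := n) (ContinuousLinearEquiv.refl ℝ E6)
    rw [← hL'] at h
    exact h.contMDiffAt.comp x₀ hLA
  · have hev := hLA.continuousAt.eventually
      (show ∀ᶠ T in 𝓝 (L'.comp (A x₀)), T ∈ Set.range ((↑) : (E6 ≃L[ℝ] E6) → (E6 →L[ℝ] E6)) by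
        rw [hL']; exact ContinuousLinearEquiv.nhds _)
    filter_upwards [hev, eventually_mem_triv x₀] with x ⟨T, hT⟩ hx v
    have h1 : incl x v = A x ((triv x₀).continuousLinearMapAt ℝ x v) := by
      exact congrArg (incl x) ((triv x₀).symmL_continuousLinearMapAt (R := ℝ) hx v).symm
    rw [h1]
    change (L'.comp (A x)).inverse (L'.comp (A x) _) = _
    rw [← hT, ContinuousLinearMap.inverse_equiv]
    exact T.symm_apply_apply _

theorem eventually_triv_snd_eq (x₀ : S6) : ∀ᶠ x in 𝓝 x₀, ∀ v : TangentSpace (𝓡 6) x,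
    (triv x₀ ⟨x, v⟩).2 = (triv x₀).continuousLinearMapAt ℝ x v := by
  filter_upwards [eventually_mem_triv x₀] with x hx v
  exact ((triv x₀).continuousLinearMapAt_apply_of_mem ℝ hx v).symm

theorem incl_eventuallyEq (Y : Π y : S6, TangentSpace (𝓡 6) y) (x₀ : S6) :
    (fun x => incl x (Y x)) =ᶠ[𝓝 x₀] fun x =>
      ((incl x).comp ((triv x₀).symmL ℝ x)) (triv x₀ ⟨x, Y x⟩).2 := by
  filter_upwards [eventually_mem_triv x₀, eventually_triv_snd_eq x₀] with x hx h
  rw [h]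
  exact congrArg (incl x) ((triv x₀).symmL_continuousLinearMapAt (R := ℝ) hx (Y x)).symm

theorem contMDiffAt_incl {n : ℕ∞ω} {Y : Π y : S6, TangentSpace (𝓡 6) y} {x₀ : S6}
    (hY : ContMDiffAt (𝓡 6) ((𝓡 6).prod 𝓘(ℝ, E6)) n
      (fun y => (⟨y, Y y⟩ : TangentBundle (𝓡 6) S6)) x₀) :
    ContMDiffAt (𝓡 6) 𝓘(ℝ, Cayley) n (fun x => incl x (Y x)) x₀ :=
  ((contMDiffAt_mvfderiv_comp_symmL (n := n + 1) contMDiff_coe.contMDiffAt le_rfl).clm_apply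
    ((contMDiffAt_section (E := (TangentSpace (𝓡 6) : S6 → Type)) x₀).1 hY))
      |>.congr_of_eventuallyEq (incl_eventuallyEq Y x₀)

theorem DiffAt.incl {Y : Π y : S6, TangentSpace (𝓡 6) y} {x₀ : S6} (hY : DiffAt Y x₀) :
    MDifferentiableAt (𝓡 6) 𝓘(ℝ, Cayley) (fun x => S6.incl x (Y x)) x₀ :=
  (((contMDiffAt_mvfderiv_comp_symmL (m := 1) (n := 2) contMDiff_coe.contMDiffAt
    le_rfl).mdifferentiableAt one_ne_zero).clm_apply
    ((mdifferentiableAt_section (𝓡 6) Y).1 hY)).congr_of_eventuallyEq (incl_eventuallyEq Y x₀)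

/-- A vector field is differentiable if it is so as a function with values in the ambient space. -/
theorem diffAt_of_incl {Y : Π y : S6, TangentSpace (𝓡 6) y} {x₀ : S6}
    (hY : MDifferentiableAt (𝓡 6) 𝓘(ℝ, Cayley) (fun x => incl x (Y x)) x₀) : DiffAt Y x₀ := by
  obtain ⟨B, hB, hBe⟩ := exists_leftInverse_incl 1 x₀
  refine (mdifferentiableAt_section (𝓡 6) Y).2
    (((hB.mdifferentiableAt one_ne_zero).clm_apply hY).congr_of_eventuallyEq ?_)
  filter_upwards [hBe, eventually_triv_snd_eq x₀] with x h1 h2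
  rw [h1, h2]

/-- A section of the endomorphism bundle is smooth if it is so as a map to the
ambient space. -/
theorem contMDiffAt_hom_of_incl {n : ℕ∞ω}
    {Φ : Π x : S6, TangentSpace (𝓡 6) x →L[ℝ] TangentSpace (𝓡 6) x} {x₀ : S6}
    (hΦ : ContMDiffAt (𝓡 6) 𝓘(ℝ, E6 →L[ℝ] Cayley) n
      (fun x => ((incl x).comp (Φ x)).comp ((triv x₀).symmL ℝ x)) x₀) :
    ContMDiffAt (𝓡 6) ((𝓡 6).prod 𝓘(ℝ, E6 →L[ℝ] E6)) n
      (fun x => (⟨x, Φ x⟩ : TotalSpace (E6 →L[ℝ] E6)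
        fun x : S6 => TangentSpace (𝓡 6) x →L[ℝ] TangentSpace (𝓡 6) x)) x₀ := by
  rw [contMDiffAt_hom_bundle]
  refine ⟨contMDiffAt_id, ?_⟩
  obtain ⟨B, hB, hBe⟩ := exists_leftInverse_incl n x₀
  refine (hB.clm_comp hΦ).congr_of_eventuallyEq ?_
  filter_upwards [hBe] with x h
  ext1 v
  exact (h _).symm

/-! ### The Lie bracket in the ambient space -/

theorem contMDiffAt_extChartAt_symm {n : ℕ∞ω} {x : S6} {e : E6}
    (he : e ∈ (extChartAt (𝓡 6) x).target) :
    ContMDiffAt 𝓘(ℝ, E6) (𝓡 6) n (extChartAt (𝓡 6) x).symm e := by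
  have h := contMDiffWithinAt_extChartAt_symm_range (I := 𝓡 6) (n := n) x he
  rwa [ModelWithCorners.range_eq_univ, contMDiffWithinAt_univ] at h

theorem isInvertible_mfderiv_extChartAt_symm {x : S6} {e : E6}
    (he : e ∈ (extChartAt (𝓡 6) x).target) :
    (mfderiv 𝓘(ℝ, E6) (𝓡 6) (extChartAt (𝓡 6) x).symm e).IsInvertible := by
  have h := isInvertible_mfderivWithin_extChartAt_symm (I := 𝓡 6) he
  rwa [ModelWithCorners.range_eq_univ, mfderivWithin_univ] at h

/-- The coordinate expression of a vector field in the preferred chart at `x`; only its values on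
the target of the chart are meaningful. -/
def chartField (x : S6) (W : Π y : S6, TangentSpace (𝓡 6) y) (e : E6) : E6 :=
  mpullbackWithin 𝓘(ℝ, E6) (𝓡 6) (extChartAt (𝓡 6) x).symm W (Set.range (𝓡 6)) e

theorem fderiv_comp_extChartAt_symm {h : S6 → Cayley} {x : S6} {e : E6}
    (he : e ∈ (extChartAt (𝓡 6) x).target)
    (hh : MDifferentiableAt (𝓡 6) 𝓘(ℝ, Cayley) h ((extChartAt (𝓡 6) x).symm e)) (v : E6) :
    fderiv ℝ (h ∘ (extChartAt (𝓡 6) x).symm) e v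
      = mvfderiv (𝓡 6) h ((extChartAt (𝓡 6) x).symm e)
          (mfderiv 𝓘(ℝ, E6) (𝓡 6) (extChartAt (𝓡 6) x).symm e v) := by
  rw [← mfderiv_eq_fderiv]
  exact mfderiv_comp_apply e hh
    ((contMDiffAt_extChartAt_symm (n := 1) he).mdifferentiableAt one_ne_zero) v

theorem fderiv_comp_chartField {h : S6 → Cayley} {x : S6} {e : E6}
    (he : e ∈ (extChartAt (𝓡 6) x).target)
    (hh : MDifferentiableAt (𝓡 6) 𝓘(ℝ, Cayley) h ((extChartAt (𝓡 6) x).symm e))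
    (W : Π y : S6, TangentSpace (𝓡 6) y) :
    fderiv ℝ (h ∘ (extChartAt (𝓡 6) x).symm) e (chartField x W e)
      = mvfderiv (𝓡 6) h ((extChartAt (𝓡 6) x).symm e) (W ((extChartAt (𝓡 6) x).symm e)) := by
  rw [fderiv_comp_extChartAt_symm he hh]
  congr 1
  unfold chartField
  rw [mpullbackWithin_apply, ModelWithCorners.range_eq_univ, mfderivWithin_univ]
  exact (isInvertible_mfderiv_extChartAt_symm he).self_apply_inverse _

theorem differentiableAt_chartField {U : Π y : S6, TangentSpace (𝓡 6) y} {x : S6}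
    (hU : DiffAt U x) : DifferentiableAt ℝ (chartField x U) (extChartAt (𝓡 6) x x) := by
  have h : DifferentiableWithinAt ℝ (chartField x U)
      ((extChartAt (𝓡 6) x).symm ⁻¹' Set.univ ∩ Set.range (𝓡 6)) (extChartAt (𝓡 6) x x) :=
    (show MDifferentiableWithinAt (𝓡 6) ((𝓡 6).prod 𝓘(ℝ, E6))
      (fun y => (⟨y, U y⟩ : TangentBundle (𝓡 6) S6)) Set.univ x from
        hU.mdifferentiableWithinAt).differentiableWithinAt_mpullbackWithin_vectorField
  rwa [ModelWithCorners.range_eq_univ, Set.preimage_univ, Set.univ_inter,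
    differentiableWithinAt_univ] at h

theorem mlieBracket_eq_chartField (V W : Π y : S6, TangentSpace (𝓡 6) y) (x : S6) :
    mlieBracket (𝓡 6) V W x = (mfderiv (𝓡 6) 𝓘(ℝ, E6) (extChartAt (𝓡 6) x) x).inverse
      (lieBracket ℝ (E := E6) (chartField x V) (chartField x W) (extChartAt (𝓡 6) x x)) := by
  have h : lieBracketWithin ℝ (chartField x V) (chartField x W)
      ((extChartAt (𝓡 6) x).symm ⁻¹' Set.univ ∩ Set.range (𝓡 6))
        = lieBracket ℝ (chartField x V) (chartField x W) := by
    rw [ModelWithCorners.range_eq_univ, Set.preimage_univ, Set.univ_inter, lieBracketWithin_univ]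
  exact h ▸ mlieBracketWithin_apply

/-- The derivative along a Lie bracket is the commutator of the derivatives, for a function with
values in a vector space and vector fields that are only differentiable at the point. -/
theorem mvfderiv_mlieBracket {f : S6 → Cayley} (hf : ContMDiff (𝓡 6) 𝓘(ℝ, Cayley) 2 f)
    {V W : Π y : S6, TangentSpace (𝓡 6) y} {x : S6} (hV : DiffAt V x) (hW : DiffAt W x)
    (hV' : MDifferentiableAt (𝓡 6) 𝓘(ℝ, Cayley) (fun y => mvfderiv (𝓡 6) f y (V y)) x)
    (hW' : MDifferentiableAt (𝓡 6) 𝓘(ℝ, Cayley) (fun y => mvfderiv (𝓡 6) f y (W y)) x) :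
    mvfderiv (𝓡 6) f x (mlieBracket (𝓡 6) V W x)
      = mvfderiv (𝓡 6) (fun y => mvfderiv (𝓡 6) f y (W y)) x (V x)
        - mvfderiv (𝓡 6) (fun y => mvfderiv (𝓡 6) f y (V y)) x (W x) := by
  have he : extChartAt (𝓡 6) x x ∈ (extChartAt (𝓡 6) x).target := mem_extChartAt_target x
  have hx : (extChartAt (𝓡 6) x).symm (extChartAt (𝓡 6) x x) = x := extChartAt_to_inv x
  have hfd (y) : MDifferentiableAt (𝓡 6) 𝓘(ℝ, Cayley) f y := (hf y).mdifferentiableAt two_ne_zero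
  have hg : ContDiffAt ℝ 2 (f ∘ (extChartAt (𝓡 6) x).symm) (extChartAt (𝓡 6) x x) :=
    contMDiffAt_iff_contDiffAt.1 ((hf _).comp _ (contMDiffAt_extChartAt_symm he))
  have hev (U : Π y : S6, TangentSpace (𝓡 6) y) :
      (fun e => fderiv ℝ (f ∘ (extChartAt (𝓡 6) x).symm) e (chartField x U e))
        =ᶠ[𝓝 (extChartAt (𝓡 6) x x)]
          (fun y => mvfderiv (𝓡 6) f y (U y)) ∘ (extChartAt (𝓡 6) x).symm := by
    filter_upwards [(isOpen_extChartAt_target (I := 𝓡 6) x).mem_nhds he] with e he'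
    exact fderiv_comp_chartField he' (hfd _) U
  have key := fderiv_apply_lieBracket hg (by simp) (differentiableAt_chartField hW)
    (differentiableAt_chartField hV)
  rw [(hev W).fderiv_eq, (hev V).fderiv_eq, fderiv_comp_chartField he (by rwa [hx]),
    fderiv_comp_chartField he (by rwa [hx]), hx] at key
  rw [← key, mlieBracket_eq_chartField, fderiv_comp_extChartAt_symm he (hfd _)]
  have hinv : (mfderiv (𝓡 6) 𝓘(ℝ, E6) (extChartAt (𝓡 6) x) x).inverse
      = mfderiv 𝓘(ℝ, E6) (𝓡 6) (extChartAt (𝓡 6) x).symm (extChartAt (𝓡 6) x x) := by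
    refine ContinuousLinearMap.inverse_eq ?_ ?_
    · have h := mfderiv_extChartAt_comp_mfderivWithin_extChartAt_symm' (I := 𝓡 6)
        (mem_extChartAt_source (I := 𝓡 6) x)
      rwa [ModelWithCorners.range_eq_univ, mfderivWithin_univ] at h
    · have h := mfderivWithin_extChartAt_symm_comp_mfderiv_extChartAt' (I := 𝓡 6)
        (mem_extChartAt_source (I := 𝓡 6) x)
      rwa [ModelWithCorners.range_eq_univ, mfderivWithin_univ] at h
  have hpt (y : S6) (hy : y = x) (v : E6) :
      (show E6 →L[ℝ] Cayley from mvfderiv (𝓡 6) f x) v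
        = (show E6 →L[ℝ] Cayley from mvfderiv (𝓡 6) f y) v := by rw [hy]
  rw [hinv]
  exact hpt _ hx _

/-! ### The characteristic connection -/

/-- The product rule for a bilinear map. -/
theorem mvfderiv_bilinear {G : Type*} [NormedAddCommGroup G] [NormedSpace ℝ G]
    (B : Cayley →L[ℝ] Cayley →L[ℝ] G) {f g : S6 → Cayley} {x : S6}
    (hf : MDifferentiableAt (𝓡 6) 𝓘(ℝ, Cayley) f x)
    (hg : MDifferentiableAt (𝓡 6) 𝓘(ℝ, Cayley) g x) (v : TangentSpace (𝓡 6) x) :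
    mvfderiv (𝓡 6) (fun y => B (f y) (g y)) x v
      = B (mvfderiv (𝓡 6) f x v) (g x) + B (f x) (mvfderiv (𝓡 6) g x v) := by
  have hB := B.isBoundedBilinearMap.hasFDerivAt (f x, g x)
  have hp : HasMFDerivAt (𝓡 6) 𝓘(ℝ, Cayley × Cayley) (fun y => (f y, g y)) x
      ((mvfderiv (𝓡 6) f x).prod (mvfderiv (𝓡 6) g x)) :=
    ⟨hf.hasMFDerivAt.1.prodMk hg.hasMFDerivAt.1, hf.hasMFDerivAt.2.prodMk hg.hasMFDerivAt.2⟩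
  have h := congrArg (fun L : TangentSpace (𝓡 6) x →L[ℝ] G => L v)
    (hB.hasMFDerivAt.comp x hp).mfderiv
  exact h.trans (add_comm _ _)

/-- A left inverse of the inclusion of the tangent space at `x` in `𝒴`. The choice of its kernel
is arbitrary, because it is applied only to vectors orthogonal to `x`. -/
def toTangent (x : S6) : Cayley →L[ℝ] TangentSpace (𝓡 6) x :=
  LinearMap.toContinuousLinearMap (LinearMap.exists_leftInverse_of_injective (incl x).toLinearMap
    (LinearMap.ker_eq_bot.2 (incl_injective x))).choose

theorem toTangent_incl (x : S6) (v : TangentSpace (𝓡 6) x) : toTangent x (incl x v) = v :=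
  congrArg (fun f : TangentSpace (𝓡 6) x →ₗ[ℝ] TangentSpace (𝓡 6) x => f v)
    (LinearMap.exists_leftInverse_of_injective (incl x).toLinearMap
      (LinearMap.ker_eq_bot.2 (incl_injective x))).choose_spec

theorem incl_toTangent {x : S6} {w : Cayley} (hw : ⟪(x : Cayley), w⟫_ℝ = 0) :
    incl x (toTangent x w) = w := by
  obtain ⟨v, rfl⟩ := exists_incl_eq x w hw
  rw [toTangent_incl]

/-- The ambient expression `X ↦ - x × (x × dY(X) + (X × Y) / 2)` of the characteristic
connection applied to a vector field `Y`, regarded as a function with values in `𝒴`: the first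
summand is the tangential component of the derivative of `Y`, the second one is half the
torsion. -/
def ambientDeriv (Y : Π y : S6, TangentSpace (𝓡 6) y) (x : S6) :
    TangentSpace (𝓡 6) x →L[ℝ] Cayley :=
  -(Cayley.crossCLM x).comp ((Cayley.crossCLM x).comp (mvfderiv (𝓡 6) (fun y => incl y (Y y)) x)
    + (1 / 2 : ℝ) • (Cayley.crossCLM.flip (incl x (Y x))).comp (incl x))

theorem ambientDeriv_apply (Y : Π y : S6, TangentSpace (𝓡 6) y) (x : S6)
    (X : TangentSpace (𝓡 6) x) :
    ambientDeriv Y x X = -cross x (cross x (mvfderiv (𝓡 6) (fun y => incl y (Y y)) x X)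
      + (1 / 2 : ℝ) • cross (incl x X) (incl x (Y x))) := rfl

theorem inner_ambientDeriv (Y : Π y : S6, TangentSpace (𝓡 6) y) (x : S6)
    (X : TangentSpace (𝓡 6) x) : ⟪(x : Cayley), ambientDeriv Y x X⟫_ℝ = 0 := by
  rw [ambientDeriv_apply, inner_neg_right, Cayley.inner_self_cross, neg_zero]

theorem cross_cross_self_of_inner_eq_zero {x : S6} {w : Cayley} (hw : ⟪(x : Cayley), w⟫_ℝ = 0) :
    cross x (cross x w) = -w := by
  rw [Cayley.cross_cross, hw, inner_self, zero_smul, one_smul, zero_sub]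

theorem ambientDeriv_add {σ τ : Π y : S6, TangentSpace (𝓡 6) y} {x : S6} (hσ : DiffAt σ x)
    (hτ : DiffAt τ x) : ambientDeriv (σ + τ) x = ambientDeriv σ x + ambientDeriv τ x := by
  have h : mvfderiv (𝓡 6) (fun y => incl y ((σ + τ) y)) x
      = mvfderiv (𝓡 6) (fun y => incl y (σ y)) x + mvfderiv (𝓡 6) (fun y => incl y (τ y)) x := by
    rw [← mvfderiv_add hσ.incl hτ.incl]
    congr 1
    ext1 y
    exact map_add (incl y) (σ y) (τ y)
  ext1 X
  have h2 : incl x ((σ + τ) x) = incl x (σ x) + incl x (τ x) := map_add _ _ _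
  rw [add_apply, ambientDeriv_apply, ambientDeriv_apply, ambientDeriv_apply, h, h2, add_apply]
  simp only [Cayley.cross_add_right, Cayley.cross_smul_right, smul_add]
  abel

theorem ambientDeriv_smul {σ : Π y : S6, TangentSpace (𝓡 6) y} {g : S6 → ℝ} {x : S6}
    (hσ : DiffAt σ x) (hg : MDifferentiableAt (𝓡 6) 𝓘(ℝ, ℝ) g x) (X : TangentSpace (𝓡 6) x) :
    ambientDeriv (g • σ) x X = g x • ambientDeriv σ x X + mvfderiv (𝓡 6) g x X • incl x (σ x) := by
  have h : mvfderiv (𝓡 6) (fun y => incl y ((g • σ) y)) x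
      = g x • mvfderiv (𝓡 6) (fun y => incl y (σ y)) x
        + (mvfderiv (𝓡 6) g x).smulRight (incl x (σ x)) := by
    rw [← mvfderiv_smul hg hσ.incl]
    congr 1
    ext1 y
    exact map_smul (incl y) (g y) (σ y)
  have h2 : incl x ((g • σ) x) = g x • incl x (σ x) :=
    (incl x).map_smul (g x) (σ x)
  rw [ambientDeriv_apply, ambientDeriv_apply, h, h2, add_apply, smul_apply,
    ContinuousLinearMap.smulRight_apply]
  simp only [Cayley.cross_add_right, Cayley.cross_smul_right]
  rw [cross_cross_self_of_inner_eq_zero (inner_incl x (σ x))]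
  module

/-- The characteristic connection of `S⁶`. -/
def charConnection : Connection where
  toFun Y x := (toTangent x).comp (ambientDeriv Y x)
  isCovariantDerivativeOnUniv :=
    { add := fun {σ τ x} hσ hτ _ => by
        rw [ambientDeriv_add hσ hτ, ContinuousLinearMap.comp_add]
      leibniz := fun {σ g x} hσ hg _ => by
        ext1 X
        apply incl_injective x
        refine (congrArg (incl x ∘ toTangent x) (ambientDeriv_smul hσ hg X)).trans ?_
        rw [Function.comp_apply, map_add, map_smul, map_smul, toTangent_incl]
        rfl }

theorem incl_charConnection (Y : Π y : S6, TangentSpace (𝓡 6) y) (x : S6)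
    (X : TangentSpace (𝓡 6) x) : incl x (charConnection Y x X) = ambientDeriv Y x X :=
  incl_toTangent (inner_ambientDeriv Y x X)

theorem contMDiff_charConnection : charConnection.ContMDiffCovariantDerivative ∞ where
  contMDiff :=
    { contMDiff := fun {σ} hσ x₀ _ => by
        have hσ' := contMDiffAt_incl (hσ.contMDiffAt (univ_mem (f := 𝓝 x₀)))
        refine (contMDiffAt_hom_of_incl (Φ := fun x => charConnection σ x) ?_).contMDiffWithinAt
        have hN : ContMDiffAt (𝓡 6) 𝓘(ℝ, Cayley →L[ℝ] Cayley) ∞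
            (fun x : S6 => Cayley.crossCLM (x : Cayley)) x₀ :=
          Cayley.crossCLM.contDiff.contMDiff.contMDiffAt.comp x₀ contMDiff_coe.contMDiffAt
        have hF : ContMDiffAt (𝓡 6) 𝓘(ℝ, Cayley →L[ℝ] Cayley) ∞
            (fun x : S6 => Cayley.crossCLM.flip (incl x (σ x))) x₀ :=
          Cayley.crossCLM.flip.contDiff.contMDiff.contMDiffAt.comp x₀ (hσ'.of_le le_self_add)
        have h1 := contMDiffAt_mvfderiv_comp_symmL hσ' le_rfl
        have h2 : ContMDiffAt (𝓡 6) 𝓘(ℝ, E6 →L[ℝ] Cayley) ∞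
            (fun x => (incl x).comp ((triv x₀).symmL ℝ x)) x₀ :=
          contMDiffAt_mvfderiv_comp_symmL (n := ∞ + 1) contMDiff_coe.contMDiffAt le_rfl
        refine (hN.clm_comp ((hN.clm_comp h1).add
          ((contDiff_const_smul (1 / 2 : ℝ)).contMDiff.contMDiffAt.comp x₀ (hF.clm_comp h2)))).neg
            |>.congr_of_eventuallyEq (Eventually.of_forall fun x => ?_)
        ext1 v
        exact incl_charConnection σ x _ }

theorem inner_ambientDeriv_incl (Y : Π y : S6, TangentSpace (𝓡 6) y) (x : S6)
    (X v : TangentSpace (𝓡 6) x) :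
    ⟪ambientDeriv Y x X, incl x v⟫_ℝ = ⟪mvfderiv (𝓡 6) (fun y => incl y (Y y)) x X, incl x v⟫_ℝ
      - (1 / 2) * ⟪cross x (cross (incl x X) (incl x (Y x))), incl x v⟫_ℝ := by
  rw [ambientDeriv_apply, Cayley.cross_add_right, Cayley.cross_smul_right, Cayley.cross_cross,
    inner_self, inner_neg_left, inner_add_left, inner_sub_left, real_inner_smul_left,
    real_inner_smul_left, real_inner_smul_left, inner_incl]
  ring

/-- The tangential derivative is metric, and the additional term is skew. -/
theorem isMetric_charConnection : IsMetric charConnection := by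
  intro x X Y Z hY hZ
  have h := mvfderiv_bilinear (innerSL ℝ) hY.incl hZ.incl X
  refine h.trans ?_
  rw [metric, metric, incl_charConnection, incl_charConnection,
    real_inner_comm (ambientDeriv Z x X), inner_ambientDeriv_incl,
    inner_ambientDeriv_incl, innerSL_apply_apply, innerSL_apply_apply,
    real_inner_comm _ (incl x (Y x)),
    Cayley.inner_cross_cross_skew (inner_incl x X) (inner_incl x (Y x)) (inner_incl x (Z x))]
  ring

theorem mvfderiv_incl_J {Y : Π y : S6, TangentSpace (𝓡 6) y} {x : S6} (hY : DiffAt Y x)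
    (X : TangentSpace (𝓡 6) x) :
    mvfderiv (𝓡 6) (fun y => incl y (J y (Y y))) x X
      = cross (incl x X) (incl x (Y x))
        + cross x (mvfderiv (𝓡 6) (fun y => incl y (Y y)) x X) := by
  simp only [incl_J]
  exact mvfderiv_bilinear Cayley.crossCLM
    ((contMDiff_coe (n := 1)).mdifferentiable one_ne_zero x) hY.incl X

theorem DiffAt.J {Y : Π y : S6, TangentSpace (𝓡 6) y} {x : S6} (hY : DiffAt Y x) :
    DiffAt (fun y => S6.J y (Y y)) x := by
  apply diffAt_of_incl
  simp only [incl_J]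
  exact (Cayley.crossCLM.differentiableAt.comp_mdifferentiableAt
    ((contMDiff_coe (n := 1)).mdifferentiable one_ne_zero x)).clm_apply hY.incl

theorem preservesJ_charConnection : PreservesJ charConnection := by
  intro x X Y hY
  apply incl_injective x
  rw [incl_J, incl_charConnection, incl_charConnection, ambientDeriv_apply, ambientDeriv_apply,
    mvfderiv_incl_J hY, incl_J]
  -- the terms without derivatives agree because of `x × (x × (X × Y) + X × (x × Y)) = 0`
  have h := congrArg (cross x)
    (Cayley.cross_cross_polar x (incl x X) (incl x (Y x)))
  rw [inner_incl, inner_incl, mul_zero, zero_smul, zero_smul, zero_add, sub_zero,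
    Cayley.cross_smul_right, Cayley.cross_self, smul_zero, Cayley.cross_add_right] at h
  simp only [normal, ← Cayley.crossCLM_apply, map_add, map_smul, map_neg] at h ⊢
  rw [eq_neg_of_add_eq_zero_right h]
  module

theorem incl_mlieBracket {X Y : Π y : S6, TangentSpace (𝓡 6) y} {x : S6} (hX : DiffAt X x)
    (hY : DiffAt Y x) : incl x (mlieBracket (𝓡 6) X Y x)
      = mvfderiv (𝓡 6) (fun y => incl y (Y y)) x (X x)
        - mvfderiv (𝓡 6) (fun y => incl y (X y)) x (Y x) :=
  mvfderiv_mlieBracket contMDiff_coe hX hY hX.incl hY.incl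

theorem incl_torsion_charConnection (x : S6) (u v : TangentSpace (𝓡 6) x) :
    incl x (charConnection.torsion x u v) = -cross x (cross (incl x u) (incl x v)) := by
  set X := FiberBundle.extend (EuclideanSpace ℝ (Fin 6)) u with hXdef
  set Y := FiberBundle.extend (EuclideanSpace ℝ (Fin 6)) v with hYdef
  have hX : DiffAt X x := FiberBundle.mdifferentiableAt_extend ..
  have hY : DiffAt Y x := FiberBundle.mdifferentiableAt_extend ..
  have hXu : X x = u := by simp [hXdef]
  have hYv : Y x = v := by simp [hYdef]
  have h := charConnection.torsion_apply hX hY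
  have hb := incl_mlieBracket hX hY
  have h0 := inner_incl x (mlieBracket (𝓡 6) X Y x)
  rw [hb, hXu, hYv, inner_sub_right] at h0
  rw [hXu, hYv] at h hb
  rw [h, map_sub, map_sub, hb, incl_charConnection, incl_charConnection, ambientDeriv_apply,
    ambientDeriv_apply, hXu, hYv, Cayley.cross_swap (incl x v) (incl x u)]
  simp only [Cayley.cross_add_right, Cayley.cross_cross x (mvfderiv _ _ _ _), inner_self,
    Cayley.cross_smul_right]
  rw [show cross x (-cross (incl x u) (incl x v)) = -cross x (cross (incl x u) (incl x v)) from
    map_neg (Cayley.crossCLM x) _, sub_eq_zero.1 h0]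
  module

/-- The torsion is `-⟨J (X × Y), Z⟩`. -/
theorem torsion3_charConnection (x : S6) (u v w : TangentSpace (𝓡 6) x) :
    torsion3 charConnection x u v w = -⟪cross x (cross (incl x u) (incl x v)), incl x w⟫_ℝ := by
  rw [torsion3, metric, incl_torsion_charConnection, inner_neg_left]

theorem isCharacteristicConnection_charConnection :
    IsCharacteristicConnection charConnection where
  metric := isMetric_charConnection
  preservesJ := preservesJ_charConnection
  skew x u v w := by
    rw [torsion3_charConnection, torsion3_charConnection,
      Cayley.inner_cross_cross_skew (inner_incl x u) (inner_incl x v) (inner_incl x w)]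

/-! ### The difference tensor of two connections -/

/-- The difference of two connections as a tensor: `diff D D' x v X` is
`∇_X Y - ∇'_X Y` at `x` for any field `Y` with value `v` at `x`. -/
def diff (D D' : Connection) (x : S6) :
    TangentSpace (𝓡 6) x →L[ℝ] TangentSpace (𝓡 6) x →L[ℝ] TangentSpace (𝓡 6) x :=
  IsCovariantDerivativeOn.difference D.isCovariantDerivativeOnUniv D'.isCovariantDerivativeOnUniv x

theorem diff_apply (D D' : Connection) {x : S6} {Y : Π y : S6, TangentSpace (𝓡 6) y}
    (hY : DiffAt Y x) (X : TangentSpace (𝓡 6) x) :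
    diff D D' x (Y x) X = D Y x X - D' Y x X := by
  unfold diff
  rw [IsCovariantDerivativeOn.difference_apply _ _ (Set.mem_univ x) hY]
  rfl

theorem exists_diffAt {x : S6} (v : TangentSpace (𝓡 6) x) :
    ∃ Y : Π y : S6, TangentSpace (𝓡 6) y, DiffAt Y x ∧ Y x = v :=
  ⟨FiberBundle.extend (EuclideanSpace ℝ (Fin 6)) v, FiberBundle.mdifferentiableAt_extend ..,
    by simp⟩

theorem metric_comm (x : S6) (u v : TangentSpace (𝓡 6) x) : metric x u v = metric x v u :=
  real_inner_comm _ _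

theorem metric_sub_left (x : S6) (u v w : TangentSpace (𝓡 6) x) :
    metric x (u - v) w = metric x u w - metric x v w := by
  rw [metric, map_sub, inner_sub_left]; rfl

theorem metric_neg_left (x : S6) (u w : TangentSpace (𝓡 6) x) :
    metric x (-u) w = - metric x u w := by
  rw [metric, map_neg, inner_neg_left]; rfl

theorem eq_zero_of_metric {x : S6} {u : TangentSpace (𝓡 6) x} (h : ∀ w, metric x u w = 0) :
    u = 0 :=
  incl_injective x ((inner_self_eq_zero.1 (h u)).trans (map_zero (incl x)).symm)

theorem J_J (x : S6) (v : TangentSpace (𝓡 6) x) : J x (J x v) = -v := by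
  apply incl_injective x
  rw [incl_J, incl_J, map_neg]
  exact cross_cross_self_of_inner_eq_zero (inner_incl x v)

theorem metric_J_left (x : S6) (u v : TangentSpace (𝓡 6) x) :
    metric x (J x u) v = - metric x u (J x v) := by
  rw [metric, metric, incl_J, incl_J, Cayley.inner_cross_left]

theorem J_sub (x : S6) (u v : TangentSpace (𝓡 6) x) : J x (u - v) = J x u - J x v := by
  apply incl_injective x
  rw [map_sub, incl_J, incl_J, incl_J, map_sub, Cayley.cross_sub_right]

/-- The difference of two metric connections takes values in the skew endomorphisms. -/
theorem metric_diff_skew {D D' : Connection} (h : IsMetric D) (h' : IsMetric D') (x : S6)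
    (u v w : TangentSpace (𝓡 6) x) :
    metric x (diff D D' x v u) w = - metric x (diff D D' x w u) v := by
  obtain ⟨Y, hY, rfl⟩ := exists_diffAt v
  obtain ⟨Z, hZ, rfl⟩ := exists_diffAt w
  rw [diff_apply D D' hY, diff_apply D D' hZ, metric_sub_left, metric_sub_left]
  have e := (h x u Y Z hY hZ).symm.trans (h' x u Y Z hY hZ)
  rw [metric_comm x (Y x), metric_comm x (Y x)] at e
  linarith

/-- The skew part of the difference tensor is the difference of the torsions. -/
theorem diff_sub_diff (D D' : Connection) (x : S6) (u v : TangentSpace (𝓡 6) x) :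
    diff D D' x v u - diff D D' x u v = D.torsion x u v - D'.torsion x u v := by
  obtain ⟨X, hX, rfl⟩ := exists_diffAt u
  obtain ⟨Y, hY, rfl⟩ := exists_diffAt v
  rw [diff_apply D D' hX, diff_apply D D' hY, D.torsion_apply hX hY, D'.torsion_apply hX hY]
  abel

theorem diff_J {D D' : Connection} (h : PreservesJ D) (h' : PreservesJ D') (x : S6)
    (u v : TangentSpace (𝓡 6) x) : diff D D' x (J x v) u = J x (diff D D' x v u) := by
  obtain ⟨Y, hY, rfl⟩ := exists_diffAt v
  have e := diff_apply D D' hY.J u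
  rw [h x u Y hY, h' x u Y hY] at e
  rw [diff_apply D D' hY, J_sub, ← e]

theorem eq_of_diff_eq_zero {D D' : Connection} {x : S6}
    (h : ∀ u v w : TangentSpace (𝓡 6) x, metric x (diff D D' x v u) w = 0)
    {Y : Π y : S6, TangentSpace (𝓡 6) y} (hY : DiffAt Y x) : D Y x = D' Y x := by
  ext1 X
  have e := eq_zero_of_metric (h X (Y x))
  rwa [diff_apply D D' hY, sub_eq_zero] at e

/-- A metric connection is determined by its torsion: the difference tensor is symmetric in the
first two arguments and skew in the last two. -/
theorem eq_of_isMetric_of_torsion3_eq {D D' : Connection} (h : IsMetric D) (h' : IsMetric D')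
    {x : S6} (ht : ∀ u v w : TangentSpace (𝓡 6) x, torsion3 D x u v w = torsion3 D' x u v w)
    {Y : Π y : S6, TangentSpace (𝓡 6) y} (hY : DiffAt Y x) : D Y x = D' Y x := by
  refine eq_of_diff_eq_zero (fun u v w => ?_) hY
  have hs := metric_diff_skew h h' x
  have ht' (u v w : TangentSpace (𝓡 6) x) :
      metric x (diff D D' x v u) w = metric x (diff D D' x u v) w := by
    rw [← sub_eq_zero, ← metric_sub_left, diff_sub_diff, metric_sub_left, sub_eq_zero]
    exact ht u v w
  linarith [hs u v w, ht' u w v, hs w u v, ht' w v u, hs v w u, ht' v u w]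

/-- Uniqueness of the characteristic connection: the difference `a(X, Y, Z)` of two of them is
totally skew and satisfies `a(X, JY, Z) = - a(X, Y, JZ)`. Moving `J` around the three arguments
changes the sign of `a(JX, Y, Z)`. -/
theorem IsCharacteristicConnection.eq {D D' : Connection} (h : IsCharacteristicConnection D)
    (h' : IsCharacteristicConnection D') {x : S6} {Y : Π y : S6, TangentSpace (𝓡 6) y}
    (hY : DiffAt Y x) : D Y x = D' Y x := by
  refine eq_of_diff_eq_zero (fun u v w => ?_) hY
  have hs := metric_diff_skew h.metric h'.metric x
  have ht (u v w : TangentSpace (𝓡 6) x) :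
      S6.metric x (diff D D' x v u) w - S6.metric x (diff D D' x u v) w
        = torsion3 D x u v w - torsion3 D' x u v w := by
    rw [← metric_sub_left, diff_sub_diff, metric_sub_left]; rfl
  -- `a` is totally skew
  have hs' (u v w : TangentSpace (𝓡 6) x) :
      S6.metric x (diff D D' x v u) w = - S6.metric x (diff D D' x u v) w := by
    linarith [ht w u v, ht w v u, h.skew x w u v, h'.skew x w u v, hs w u v, hs u v w, hs v u w]
  have hJ (u v w : TangentSpace (𝓡 6) x) :
      S6.metric x (diff D D' x (J x v) u) w = - S6.metric x (diff D D' x v u) (J x w) := by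
    rw [diff_J h.preservesJ h'.preservesJ, metric_J_left]
  have key (u v w : TangentSpace (𝓡 6) x) : S6.metric x (diff D D' x v (J x u)) w = 0 := by
    linarith [hJ u v w, hs' (J x u) v w, hJ v u w, hs' v u (J x w), hs (J x u) v w,
      hs' (J x u) w v, hJ w u v, hs' w u (J x v), hs u w (J x v)]
  have := key (J x u) v w
  rwa [J_J, map_neg, metric_neg_left, neg_eq_zero] at this

end S6

/-! ### The canonical connection -/

/-- A reductive complement is mapped onto `o^⊥ = T_o S⁶` by the evaluation at `o`. -/
theorem IsReductiveComplement.exists_apply_eq {o : S6} {m : Submodule ℝ g2}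
    (hm : IsReductiveComplement o m) {w : Cayley} (hw : ⟪(o : Cayley), w⟫_ℝ = 0) :
    ∃ X ∈ m, X.1 o = w := by
  obtain ⟨D, rfl⟩ := g2.exists_apply_eq o hw
  obtain ⟨H, hH, X, hX, rfl⟩ := Submodule.mem_sup.1
    (hm.isCompl.sup_eq_top ▸ Submodule.mem_top : D ∈ isotropyAlgebra o ⊔ m)
  refine ⟨X, hX, ?_⟩
  have hH' : H.1 (o : Cayley) = 0 := hH
  rw [g2.coe_add, add_apply, hH', zero_add]

namespace S6

theorem exists_mem_apply_eq_incl {o x : S6} {m : Submodule ℝ g2}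
    (hm : IsReductiveComplement o m) {g : G2} (hx : (x : Cayley) = G2.toLin g o)
    (u : TangentSpace (𝓡 6) x) : ∃ X ∈ m, incl x u = G2.toLin g (X.1 o) := by
  have hu : ⟪(o : Cayley), G2.toLin g⁻¹ (incl x u)⟫_ℝ = 0 := by
    have h := G2.inner_toLin g o (G2.toLin g⁻¹ (incl x u))
    rw [G2.toLin_apply_inv, ← hx] at h
    exact h.symm.trans (inner_incl x u)
  obtain ⟨X, hX, h⟩ := hm.exists_apply_eq hu
  exact ⟨X, hX, by rw [h, G2.toLin_apply_inv]⟩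

/-- The invariant tensor on `S⁶` defined by the bracket of `m`, at the point `g • o`. -/
theorem innerM_bracketM {o : S6} {m : Submodule ℝ g2} (hm : IsReductiveComplement o m) (g : G2)
    {X Y Z : g2} (hX : X ∈ m) (hY : Y ∈ m) :
    innerM o (bracketM hm X Y) Z = ⟪cross (g • o : S6)
      (cross (G2.toLin g (X.1 o)) (G2.toLin g (Y.1 o))), G2.toLin g (Z.1 o)⟫_ℝ := by
  rw [innerM, hm.bracketM_apply_base_of_mem hX hY, G2.coe_smul, ← G2.toLin_cross,
    ← G2.toLin_cross, G2.inner_toLin]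

theorem torsion3_charConnection_of_incl_eq {x : S6} {u v w : TangentSpace (𝓡 6) x}
    {A B C : Cayley} (hu : incl x u = A) (hv : incl x v = B) (hw : incl x w = C) :
    torsion3 charConnection x u v w = -⟪cross x (cross A B), C⟫_ℝ := by
  subst hu hv hw
  exact torsion3_charConnection x u v w

/-- The canonical connection is the metric connection with the torsion of `charConnection`. -/
theorem isCanonicalConnection_iff {o : S6} {m : Submodule ℝ g2} (hm : IsReductiveComplement o m)
    (D : Connection) : IsCanonicalConnection hm D ↔ IsMetric D ∧
      ∀ (x : S6) (u v w : TangentSpace (𝓡 6) x),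
        torsion3 D x u v w = torsion3 charConnection x u v w := by
  constructor
  · refine fun h => ⟨h.metric, fun x u v w => ?_⟩
    obtain ⟨g, hg⟩ : ∃ g : G2, g • o = x := MulAction.exists_smul_eq G2 o x
    have hx : (x : Cayley) = G2.toLin g o := by rw [← hg, G2.coe_smul]
    obtain ⟨X, hX, hu⟩ := exists_mem_apply_eq_incl hm hx u
    obtain ⟨Y, hY, hv⟩ := exists_mem_apply_eq_incl hm hx v
    obtain ⟨Z, hZ, hw⟩ := exists_mem_apply_eq_incl hm hx w
    subst hg
    have h1 := h.torsion g X hX Y hY Z hZ u v w hu hv hw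
    have h2 := torsion3_charConnection_of_incl_eq hu hv hw
    exact h1.trans ((congrArg Neg.neg (innerM_bracketM hm g hX hY)).trans h2.symm)
  · refine fun h => ⟨h.1, fun g X hX Y hY Z _ u v w hu hv hw => ?_⟩
    have h2 := torsion3_charConnection_of_incl_eq hu hv hw
    exact (h.2 _ u v w).trans (h2.trans (congrArg Neg.neg (innerM_bracketM hm g hX hY).symm))

/-- Being characteristic only depends on the values of a connection on differentiable fields. -/
theorem IsCharacteristicConnection.congr {D D' : Connection} (h : IsCharacteristicConnection D)
    (e : ∀ (x : S6) (Y : Π y : S6, TangentSpace (𝓡 6) y), DiffAt Y x → D' Y x = D Y x) :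
    IsCharacteristicConnection D' where
  metric x X Y Z hY hZ := by rw [e x Y hY, e x Z hZ]; exact h.metric x X Y Z hY hZ
  preservesJ x X Y hY := by rw [e x _ hY.J, e x Y hY]; exact h.preservesJ x X Y hY
  skew := by
    have ht (x : S6) (u v w : TangentSpace (𝓡 6) x) : torsion3 D' x u v w = torsion3 D x u v w := by
      obtain ⟨X, hX, rfl⟩ := exists_diffAt u
      obtain ⟨Y, hY, rfl⟩ := exists_diffAt v
      rw [torsion3, torsion3, D.torsion_apply hX hY, D'.torsion_apply hX hY, e x X hX, e x Y hY]
    intro x u v w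
    rw [ht, ht]
    exact h.skew x u v w

theorem IsCharacteristicConnection.torsion3_eq {D : Connection}
    (h : IsCharacteristicConnection D) (x : S6) (u v w : TangentSpace (𝓡 6) x) :
    torsion3 D x u v w = torsion3 charConnection x u v w := by
  obtain ⟨X, hX, rfl⟩ := exists_diffAt u
  obtain ⟨Y, hY, rfl⟩ := exists_diffAt v
  rw [torsion3, torsion3, D.torsion_apply hX hY, charConnection.torsion_apply hX hY,
    h.eq isCharacteristicConnection_charConnection hX,
    h.eq isCharacteristicConnection_charConnection hY]

theorem isCanonicalConnection_iff_isCharacteristicConnection {o : S6} {m : Submodule ℝ g2}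
    (hm : IsReductiveComplement o m) (D : Connection) :
    IsCanonicalConnection hm D ↔ IsCharacteristicConnection D := by
  rw [isCanonicalConnection_iff]
  exact ⟨fun h => isCharacteristicConnection_charConnection.congr fun x _ hY =>
      eq_of_isMetric_of_torsion3_eq h.1 isMetric_charConnection (h.2 x) hY,
    fun h => ⟨h.metric, h.torsion3_eq⟩⟩

end S6
end

theorem mainTheorem4 (o : S6) :
    -- `G₂` acts on `S⁶` by isometries of the round metric
    (∀ (g : G2) (A B : Cayley), ⟪G2.toLin g A, G2.toLin g B⟫_ℝ = ⟪A, B⟫_ℝ) ∧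
    -- `S⁶ = G₂ / SU(3)`: the orbit map is a submersion, it induces a homeomorphism, and the
    -- isotropy group is `SU(3)`
    (∀ w : Cayley, ⟪(o : Cayley), w⟫_ℝ = 0 → ∃ D : g2, D.1 o = w) ∧
    IsHomeomorph (MulAction.ofQuotientStabilizer G2 o) ∧
    Nonempty (MulAction.stabilizer G2 o ≃ₜ* Matrix.specialUnitaryGroup (Fin 3) ℂ) ∧
    -- the homogeneous space is naturally reductive
    (∃ m : Submodule ℝ g2, IsNaturallyReductive o m) ∧
    -- the characteristic connection exists and is unique
    (∃ D : S6.Connection, D.ContMDiffCovariantDerivative ∞ ∧ S6.IsCharacteristicConnection D) ∧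
    (∀ D D' : S6.Connection, S6.IsCharacteristicConnection D → S6.IsCharacteristicConnection D' →
      ∀ (x : S6) (Y : Π y : S6, TangentSpace (𝓡 6) y), S6.DiffAt Y x → D Y x = D' Y x) ∧
    -- the canonical connection is the characteristic connection
    (∀ (m : Submodule ℝ g2) (hm : IsNaturallyReductive o m) (D : S6.Connection),
      S6.IsCanonicalConnection hm.reductive D ↔ S6.IsCharacteristicConnection D) ∧
    -- its torsion
    (∀ D : S6.Connection, S6.IsCharacteristicConnection D →
      ∀ (x : S6) (X Y Z : TangentSpace (𝓡 6) x),
        S6.torsion3 D x X Y Z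
            = - ⟪S6.ambientJ x (Cayley.cross (S6.incl x X) (S6.incl x Y)), S6.incl x Z⟫_ℝ ∧
        S6.torsion3 D x X Y Z
            = - ⟪S6.normal x,
                Cayley.cross (Cayley.cross (S6.incl x X) (S6.incl x Y)) (S6.incl x Z)⟫_ℝ) := by
  refine ⟨G2.inner_toLin, fun w hw => g2.exists_apply_eq o hw, G2.isHomeomorph_orbit o,
    SU3.nonempty_stabilizer_equiv o,
    ⟨transvections o, (isReductiveComplement_transvections o).isNaturallyReductive⟩,
    ⟨S6.charConnection, S6.contMDiff_charConnection,
      S6.isCharacteristicConnection_charConnection⟩,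
    fun D D' h h' x Y hY => h.eq h' hY,
    fun m hm D => S6.isCanonicalConnection_iff_isCharacteristicConnection hm.reductive D,
    fun D h x X Y Z => ?_⟩
  have ht := (h.torsion3_eq x X Y Z).trans (S6.torsion3_charConnection x X Y Z)
  refine ⟨ht, ht.trans ?_⟩
  rw [S6.normal, Cayley.cross_swap (x : Cayley), inner_neg_left, Cayley.inner_cross_left, neg_neg]
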